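/- Let $L$ be the relational signature with a binary symbol $<$ and, for each $n\in\mathbb N=\{0,1,2,\dots\}$, an $(n+1)$-ary symbol $R_n$. Let $T_0$ be the theory stating that $<$ is a (strict) linear order and that, for each $n$, $R_n(z_0,\dots,z_n)$ implies that $z_0,\dots,z_n$ are pairwise distinct. Let $K$ be the class of finitely generated (equivalently, finite) models of $T_0$. Then there is a Fraïssé limit of $K$, i.e. a countable $L$-structure $M$ whose finitely generated substructures are, up to isomorphism, exactly the members of $K$, and such that every isomorphism between finitely generated substructures of $M$ extends to an automorphism of $M$. For any such $M$, work in the universe of set theory with atoms (ZFA, with choice) whose set of atoms is $A=\operatorname{dom}(M)$, and let $\mathcal G$ be the group of all permutations of $A$ that preserve $<^M$ and all $R_n^M$ in both directions. Call an object $x$ symmetric if it has a finite support, i.e. there is a finite $E\subseteq A$ such that every $\pi\in\mathcal G$ fixing $E$ pointwise satisfies $\pi x=x$. Let $\mathcal V_c$ be the permutation model consisting of all hereditarily symmetric objects. If $\mathfrak m$ denotes the cardinality of the set $A$ of atoms in $\mathcal V_c$, then $$\mathcal V_c\models \operatorname{Seq}(\mathfrak m)<2^{\mathfrak m}<\operatorname{seq}(\mathfrak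 m).$$ Here $\operatorname{Seq}(\mathfrak m)$, $2^{\mathfrak m}$ and $\operatorname{seq}(\mathfrak m)$ are the cardinalities, in the sense of the model, of the set of all finite one-to-one sequences of elements of $A$, of the power set of $A$, and of the set of all finite sequences of elements of $A$; and $\mathfrak p<\mathfrak q$ means that, for sets $x,y$ of cardinality $\mathfrak p,\mathfrak q$, the model contains a one-to-one function from $x$ into $y$ but none from $y$ into $x$. -/

import Mathlib

universe u v

/-! ### The universe of set theory with atoms over a type `A` of atoms -/

namespace ZFA

/-- Pre-objects: an atom, or a family of pre-objects indexed by a small type. -/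
inductive Pre (A : Type u) : Type (u + 1)
  | atom (a : A) : Pre A
  | mk (ι : Type u) (f : ι → Pre A) : Pre A

namespace Pre

variable {A : Type u}

/-- Extensional equality of pre-objects. Distinct atoms are different, and an atom is never equal to
a set (in particular not to the empty set). -/
def Equiv : Pre A → Pre A → Prop
  | .atom a, .atom b => a = b
  | .mk _ f, .mk _ g => (∀ i, ∃ j, Equiv (f i) (g j)) ∧ (∀ j, ∃ i, Equiv (f i) (g j))
  | .atom _, .mk _ _ => False
  | .mk _ _, .atom _ => False

theorem Equiv.refl : ∀ x : Pre A, Equiv x x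
  | .atom _ => rfl
  | .mk _ f => ⟨fun i => ⟨i, Equiv.refl (f i)⟩, fun i => ⟨i, Equiv.refl (f i)⟩⟩

theorem Equiv.symm : ∀ {x y : Pre A}, Equiv x y → Equiv y x
  | .atom _, .atom _, h => Eq.symm h
  | .mk _ _, .mk _ _, h =>
    ⟨fun j => (h.2 j).imp fun _ => Equiv.symm, fun i => (h.1 i).imp fun _ => Equiv.symm⟩
  | .atom _, .mk _ _, h => h.elim
  | .mk _ _, .atom _, h => h.elim

theorem Equiv.trans : ∀ {x y z : Pre A}, Equiv x y → Equiv y z → Equiv x z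
  | .atom _, .atom _, .atom _, h, k => Eq.trans h k
  | .mk _ _, .mk _ _, .mk _ _, h, k =>
    ⟨fun i =>
      let ⟨j, hj⟩ := h.1 i
      let ⟨l, hl⟩ := k.1 j
      ⟨l, Equiv.trans hj hl⟩,
     fun l =>
      let ⟨j, hj⟩ := k.2 l
      let ⟨i, hi⟩ := h.2 j
      ⟨i, Equiv.trans hi hj⟩⟩
  | .atom _, .mk _ _, _, h, _ => h.elim
  | .mk _ _, .atom _, _, h, _ => h.elim
  | _, .atom _, .mk _ _, _, k => k.elim
  | _, .mk _ _, .atom _, _, k => k.elim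

instance setoid (A : Type u) : Setoid (Pre A) := ⟨Equiv, Equiv.refl, Equiv.symm, Equiv.trans⟩

/-- Membership of pre-objects; atoms have no elements. -/
def Mem (x : Pre A) : Pre A → Prop
  | .atom _ => False
  | .mk _ f => ∃ i, Equiv x (f i)

theorem Mem.congr : ∀ {x x' y y' : Pre A}, Equiv x x' → Equiv y y' → Mem x y → Mem x' y'
  | _, _, .mk _ _, .mk _ _, hx, hy, ⟨i, hi⟩ =>
    let ⟨j, hj⟩ := hy.1 i
    ⟨j, (hx.symm.trans hi).trans hj⟩
  | _, _, .atom _, _, _, _, h => h.elim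
  | _, _, .mk _ _, .atom _, _, hy, _ => hy.elim

/-- A permutation of the atoms acts on all pre-objects. -/
def perm (π : Equiv.Perm A) : Pre A → Pre A
  | .atom a => .atom (π a)
  | .mk ι f => .mk ι fun i => perm π (f i)

theorem perm_congr (π : Equiv.Perm A) :
    ∀ {x y : Pre A}, Equiv x y → Equiv (perm π x) (perm π y)
  | .atom _, .atom _, h => congrArg π h
  | .mk _ _, .mk _ _, h =>
    ⟨fun i => (h.1 i).imp fun _ => perm_congr π, fun j => (h.2 j).imp fun _ => perm_congr π⟩
  | .atom _, .mk _ _, h => h.elim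
  | .mk _ _, .atom _, h => h.elim

end Pre

/-- The full universe of sets and atoms over `A`, a model of ZFA with the axiom of choice. -/
def Univ (A : Type u) : Type (u + 1) := Quotient (Pre.setoid A)

namespace Univ

variable {A : Type u}

/-- The object of the universe given by an atom. -/
def atom (a : A) : Univ A := Quotient.mk _ (Pre.atom a)

/-- Membership in the universe. -/
def Mem (x y : Univ A) : Prop :=
  Quotient.liftOn₂ x y Pre.Mem fun _ _ _ _ hx hy =>
    propext ⟨Pre.Mem.congr hx hy, Pre.Mem.congr (Pre.Equiv.symm hx) (Pre.Equiv.symm hy)⟩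

/-- The automorphism of the universe induced by a permutation of the atoms. -/
def perm (π : Equiv.Perm A) (x : Univ A) : Univ A :=
  Quotient.map (Pre.perm π) (fun _ _ h => Pre.perm_congr π h) x

end Univ

/-! ### Permutation models with finite supports -/

section Symmetric

variable {A : Type u}

/-- `E` is a support of `x` with respect to `G`: every element of `G` that fixes `E` pointwise
fixes `x`. -/
def IsSupport (G : Subgroup (Equiv.Perm A)) (E : Finset A) (x : Univ A) : Prop :=
  ∀ π ∈ G, (∀ a ∈ E, π a = a) → Univ.perm π x = x

/-- `x` is symmetric: its stabilizer belongs to the normal filter generated by the pointwise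
stabilizers of finite sets of atoms, that is, `x` has a finite support. -/
def IsSymmetric (G : Subgroup (Equiv.Perm A)) (x : Univ A) : Prop :=
  ∃ E : Finset A, IsSupport G E x

/-- `x` is hereditarily symmetric: `x` is symmetric and all its elements are hereditarily
symmetric. -/
inductive HereditarilySymmetric (G : Subgroup (Equiv.Perm A)) : Univ A → Prop
  | intro (x : Univ A) (symm : IsSymmetric G x)
      (mem : ∀ y, Univ.Mem y x → HereditarilySymmetric G y) : HereditarilySymmetric G x

/-- The permutation model given by `G` and finite supports: the class of all hereditarily symmetric
objects. -/
def PermModel (G : Subgroup (Equiv.Perm A)) : Type (u + 1) :=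
  { x : Univ A // HereditarilySymmetric G x }

end Symmetric

/-! ### Set theory inside a structure

The following definitions are formulas of the language of set theory with atoms, interpreted in a
structure `V`: all quantifiers range over `V` only. -/

/-- A structure for the language of set theory with atoms. -/
class SetStructure (V : Type v) where
  /-- the membership relation -/
  mem : V → V → Prop
  /-- the predicate of being an atom -/
  isAtom : V → Prop

/-- A permutation model, with the membership relation and the atoms of the full universe. -/
instance {A : Type u} (G : Subgroup (Equiv.Perm A)) : SetStructure (PermModel G) where
  mem x y := Univ.Mem x.1 y.1
  isAtom x := ∃ a : A, x.1 = Univ.atom a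

section Internal

variable {V : Type v} [SetStructure V]

local infix:50 " ∈' " => SetStructure.mem

/-- `x` is a set, that is, not an atom. -/
def IsSet (x : V) : Prop := ¬ SetStructure.isAtom x

/-- `x` is a set and a subset of `y`. -/
def IsSubset (x y : V) : Prop := IsSet x ∧ ∀ z : V, z ∈' x → z ∈' y

/-- `p = {x, y}`. -/
def IsUnorderedPair (p x y : V) : Prop := IsSet p ∧ ∀ z : V, z ∈' p ↔ z = x ∨ z = y

/-- `p = ⟨x, y⟩ = {{x}, {x, y}}`. -/
def IsPair (p x y : V) : Prop :=
  ∃ s t : V, IsUnorderedPair s x x ∧ IsUnorderedPair t x y ∧ IsUnorderedPair p s t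

/-- `⟨x, y⟩` is an element of `f`. -/
def Maps (f x y : V) : Prop := ∃ p : V, IsPair p x y ∧ p ∈' f

/-- `f` is a function from the set `x` into the set `y`. -/
def IsFunction (f x y : V) : Prop :=
  IsSet f ∧ IsSet x ∧ IsSet y ∧
  (∀ p : V, p ∈' f → ∃ a b : V, a ∈' x ∧ b ∈' y ∧ IsPair p a b) ∧
  ∀ a : V, a ∈' x → ∃! b : V, Maps f a b

/-- `f` is a one-to-one function from the set `x` into the set `y`. -/
def IsInjection (f x y : V) : Prop :=
  IsFunction f x y ∧ ∀ a a' b : V, Maps f a b → Maps f a' b → a = a'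

/-- The cardinality of `x` is at most that of `y`: there is a one-to-one function from `x` into
`y`. -/
def CardLE (x y : V) : Prop := ∃ f : V, IsInjection f x y

/-- The cardinality of `x` is strictly smaller than that of `y`. -/
def CardLT (x y : V) : Prop := CardLE x y ∧ ¬ CardLE y x

/-- `x` is an ordinal: a set of sets, each element of `x` is a subset of `x`, and `x` is
well-ordered by membership. -/
def IsOrdinal (x : V) : Prop :=
  IsSet x ∧
  (∀ y : V, y ∈' x → IsSubset y x) ∧
  (∀ y : V, y ∈' x → ¬ y ∈' y) ∧
  (∀ y z w : V, y ∈' x → z ∈' x → w ∈' x → y ∈' z → z ∈' w → y ∈' w) ∧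
  (∀ y z : V, y ∈' x → z ∈' x → y ∈' z ∨ y = z ∨ z ∈' y) ∧
  ∀ s : V, IsSubset s x → (∃ y : V, y ∈' s) → ∃ y : V, y ∈' s ∧ ∀ z : V, z ∈' s → ¬ z ∈' y

/-- `x` is the empty set. -/
def IsEmptySet (x : V) : Prop := IsSet x ∧ ∀ y : V, ¬ y ∈' x

/-- `x = y ∪ {y}` for some set `y`. -/
def IsSuccessor (x : V) : Prop :=
  IsSet x ∧ ∃ y : V, IsSet y ∧ ∀ z : V, z ∈' x ↔ z ∈' y ∨ z = y

/-- `n` is a natural number, that is, a finite ordinal: `n` and all its elements are empty or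
successors. -/
def IsNatural (n : V) : Prop :=
  IsOrdinal n ∧ (IsEmptySet n ∨ IsSuccessor n) ∧
  ∀ y : V, y ∈' n → IsEmptySet y ∨ IsSuccessor y

/-- `m` is the set of all atoms. -/
def IsSetOfAtoms (m : V) : Prop := IsSet m ∧ ∀ x : V, x ∈' m ↔ SetStructure.isAtom x

/-- `p` is the power set of `m`. -/
def IsPowerSet (p m : V) : Prop := IsSet p ∧ ∀ x : V, x ∈' p ↔ IsSubset x m

/-- `s` is the set of all finite sequences of elements of `m`. -/
def IsSetOfSeq (s m : V) : Prop :=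
  IsSet s ∧ ∀ x : V, x ∈' s ↔ ∃ n : V, IsNatural n ∧ IsFunction x n m

/-- `s` is the set of all finite one-to-one sequences of elements of `m`. -/
def IsSetOfInjSeq (s m : V) : Prop :=
  IsSet s ∧ ∀ x : V, x ∈' s ↔ ∃ n : V, IsNatural n ∧ IsInjection x n m

end Internal

/-- The statement, interpreted in `V`, that the cardinality `𝔪` of the set of atoms satisfies
`Seq(𝔪) < 2 ^ 𝔪 < seq(𝔪)`, where `Seq` refers to finite one-to-one sequences and `seq` to all
finite sequences. -/
def InjSeqLTPowerLTSeq (V : Type v) [SetStructure V] : Prop :=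
  ∃ m injSeqs power seqs : V,
    IsSetOfAtoms m ∧ IsSetOfInjSeq injSeqs m ∧ IsPowerSet power m ∧ IsSetOfSeq seqs m ∧
    CardLT injSeqs power ∧ CardLT power seqs

end ZFA

/-! ### The structure of atoms -/

namespace Categorical

/-- The relation symbols: a binary symbol `<`, and an `(n+1)`-ary symbol `R n` for each `n`. -/
inductive Rel : ℕ → Type
  | lt : Rel 2
  | R (n : ℕ) : Rel (n + 1)

/-- The relational signature with the symbols `<` and `R n`, for `n = 0, 1, 2, …`. -/
def sig : FirstOrder.Language.{0, 0} := ⟨fun _ => Empty, Rel⟩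

instance : sig.IsRelational := fun _ => inferInstanceAs (IsEmpty Empty)

instance : Countable (Σ l, sig.Functions l) := inferInstance

/-- The models of the theory: `<` is a (strict) linear order, and `R n` holds only of
tuples of pairwise distinct elements. -/
def IsModel (N : Type u) [sig.Structure N] : Prop :=
  IsStrictTotalOrder N (fun x y => FirstOrder.Language.Structure.RelMap (L := sig) Rel.lt ![x, y]) ∧
  ∀ (n : ℕ) (z : Fin (n + 1) → N),
    FirstOrder.Language.Structure.RelMap (L := sig) (Rel.R n) z → Function.Injective z

/-- The class of finitely generated models. -/
def finModels : Set (CategoryTheory.Bundled.{u} sig.Structure) :=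
  { N | FirstOrder.Language.Structure.FG sig N ∧ IsModel N }

/-- The group of all permutations of `M` that preserve `<` and all `R n` in both directions. -/
def autGroup (M : Type u) [sig.Structure M] : Subgroup (Equiv.Perm M) where
  carrier := { π | ∀ (n : ℕ) (r : sig.Relations n) (x : Fin n → M),
    FirstOrder.Language.Structure.RelMap r (π ∘ x) ↔ FirstOrder.Language.Structure.RelMap r x }
  one_mem' := fun _ _ _ => Iff.rfl
  mul_mem' := fun {π ρ} hπ hρ n r x => (hπ n r (ρ ∘ x)).trans (hρ n r x)
  inv_mem' := fun {π} hπ n r x => by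
    have h := hπ n r (⇑π⁻¹ ∘ x)
    have e : ⇑π ∘ (⇑π⁻¹ ∘ x) = x := by
      funext i
      simp
    rw [e] at h
    exact h.symm

end Categorical

/-!
The proof rests on two facts about the countable structure `M`. It is *generic*: over a finite set
of points every cut and every choice of the relations with distinct points of the set is realized by
a new point (`Generic`). It is homogeneous, so two points outside a finite set `E` are conjugate
over `E` as soon as they stand in the same relations to `E` (`SameType.exists_perm`). Since `R n`
holds only of tuples without repetitions, there are only finitely many types over `E`, and hence `E`
supports only finitely many sets of points (`finite_supports`).

A Fraïssé limit is obtained on the rationals (`RatModel`). The rationals are split into dense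
classes indexed by the finite sets of patterns of relations; whether `R n` holds of a tuple is read
off from the class of the entry that comes last in an enumeration. Any countable generic model
embeds all finite models and is homogeneous by back and forth (`isExtensionPair_of_generic`), and as
Fraïssé limits are unique up to isomorphism, all of them are generic.

In the permutation model, the natural numbers, the finite sequences of atoms and the symmetric sets
of atoms are the true ones, and injections of the model are injections of the full universe that
commute with all automorphisms fixing some finite set of atoms (`cardLE_of_equivariant`,
`CardLE.exists_equivariant`). The four parts of the claim are then as follows.

* `Seq(𝔪) ≤ 2 ^ 𝔪`: a one-to-one sequence `z` of length `n` is mapped to the set of all `x` with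
  `R n (z, x)`; this is one-to-one by genericity (`relSet_injOn`).
* `2 ^ 𝔪 ≤ seq(𝔪)`: a symmetric set `X` has a least support (`exists_least_support`). Up to
  automorphisms there are only countably many symmetric sets, and `X` is determined by its least
  support, listed in increasing order, and the number of its orbit. Two fixed atoms serve to write
  this number into a sequence (`exists_equivariant_code`).
* `2 ^ 𝔪 ≰ Seq(𝔪)`: an injection with support `E` maps the sets supported by `E`, which are finite
  in number, to one-to-one sequences in `E`, and these are embedded by the first map into the sets
  supported by `E` other than the empty set.
* `seq(𝔪) ≰ 2 ^ 𝔪`: there are infinitely many sequences with entries in a nonempty finite set, but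
  only finitely many sets supported by it.
-/

namespace ZFA

namespace Univ

variable {A : Type u}

/-! ### The universe of sets and atoms -/

/-- The object of the universe given by a pre-object. -/
def ofPre (x : Pre A) : Univ A := Quotient.mk _ x

/-- A pre-object that represents a given object. -/
noncomputable def rep (x : Univ A) : Pre A := Quotient.out x

@[simp] theorem ofPre_rep (x : Univ A) : ofPre (rep x) = x := Quotient.out_eq x

theorem ofPre_eq_iff {x y : Pre A} : ofPre x = ofPre y ↔ Pre.Equiv x y := Quotient.eq

theorem exists_ofPre (x : Univ A) : ∃ p, x = ofPre p := ⟨rep x, (ofPre_rep x).symm⟩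

/-- The set `{f i | i}` in the universe. -/
noncomputable def mkSet {ι : Type u} (f : ι → Univ A) : Univ A :=
  ofPre (Pre.mk ι fun i => rep (f i))

theorem ofPre_mk {ι : Type u} (f : ι → Pre A) :
    ofPre (Pre.mk ι f) = mkSet fun i => ofPre (f i) := by
  refine Quotient.sound ⟨fun i => ⟨i, ?_⟩, fun i => ⟨i, ?_⟩⟩ <;>
  · rw [← ofPre_eq_iff, ofPre_rep]

@[simp] theorem mem_mkSet {ι : Type u} {f : ι → Univ A} {y : Univ A} :
    Mem y (mkSet f) ↔ ∃ i, y = f i := by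
  obtain ⟨y, rfl⟩ := exists_ofPre y
  change (∃ i, Pre.Equiv y (rep (f i))) ↔ _
  simp only [← ofPre_eq_iff, ofPre_rep]

theorem atom_or_mkSet (x : Univ A) :
    (∃ a, x = atom a) ∨ ∃ (ι : Type u) (f : ι → Univ A), x = mkSet f := by
  obtain ⟨x, rfl⟩ := exists_ofPre x
  cases x with
  | atom a => exact Or.inl ⟨a, rfl⟩
  | mk ι f => exact Or.inr ⟨ι, _, ofPre_mk f⟩

theorem mkSet_ne_atom {ι : Type u} (f : ι → Univ A) (a : A) : mkSet f ≠ atom a :=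
  fun h => (ofPre_eq_iff.1 h).elim

@[simp] theorem atom_inj {a b : A} : (atom a = atom b) ↔ a = b := ofPre_eq_iff

@[simp] theorem not_mem_atom (x : Univ A) (a : A) : ¬ Mem x (atom a) := by
  obtain ⟨x, rfl⟩ := exists_ofPre x
  exact id

theorem ext {x y : Univ A} (hx : ∀ a, x ≠ atom a) (hy : ∀ a, y ≠ atom a)
    (h : ∀ z, Mem z x ↔ Mem z y) : x = y := by
  obtain ⟨a, rfl⟩ | ⟨ι, f, rfl⟩ := atom_or_mkSet x
  · exact (hx a rfl).elim
  obtain ⟨a, rfl⟩ | ⟨κ, g, rfl⟩ := atom_or_mkSet y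
  · exact (hy a rfl).elim
  simp only [mem_mkSet] at h
  refine Quotient.sound ⟨fun i => ?_, fun j => ?_⟩
  · obtain ⟨j, hj⟩ := (h (f i)).1 ⟨i, rfl⟩
    exact ⟨j, by rw [← ofPre_eq_iff, ofPre_rep, ofPre_rep, hj]⟩
  · obtain ⟨i, hi⟩ := (h (g j)).2 ⟨j, rfl⟩
    exact ⟨i, by rw [← ofPre_eq_iff, ofPre_rep, ofPre_rep, hi]⟩

/-- Induction along membership. -/
theorem mem_induction {P : Univ A → Prop} (h : ∀ x, (∀ y, Mem y x → P y) → P x) (x : Univ A) :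
    P x := by
  obtain ⟨x, rfl⟩ := exists_ofPre x
  induction x with
  | atom a => exact h _ fun y hy => (not_mem_atom y a hy).elim
  | mk ι f ih =>
    refine h _ fun y hy => ?_
    rw [ofPre_mk, mem_mkSet] at hy
    obtain ⟨i, rfl⟩ := hy
    exact ih i

@[simp] theorem perm_atom (π : Equiv.Perm A) (a : A) : perm π (atom a) = atom (π a) := rfl

@[simp] theorem perm_mkSet (π : Equiv.Perm A) {ι : Type u} (f : ι → Univ A) :
    perm π (mkSet f) = mkSet fun i => perm π (f i) := by
  refine (ofPre_mk fun i => Pre.perm π (rep (f i))).trans (congrArg mkSet (funext fun i => ?_))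
  conv_rhs => rw [← ofPre_rep (f i)]
  rfl

theorem perm_one (x : Univ A) : perm 1 x = x := by
  induction x using mem_induction with
  | h x ih =>
    obtain ⟨a, rfl⟩ | ⟨ι, f, rfl⟩ := atom_or_mkSet x
    · rfl
    · rw [perm_mkSet]
      exact congrArg mkSet (funext fun i => ih _ (mem_mkSet.2 ⟨i, rfl⟩))

theorem perm_mul (π ρ : Equiv.Perm A) (x : Univ A) : perm (π * ρ) x = perm π (perm ρ x) := by
  induction x using mem_induction with
  | h x ih =>
    obtain ⟨a, rfl⟩ | ⟨ι, f, rfl⟩ := atom_or_mkSet x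
    · rfl
    · simp only [perm_mkSet]
      exact congrArg mkSet (funext fun i => ih _ (mem_mkSet.2 ⟨i, rfl⟩))

theorem perm_inv_perm (π : Equiv.Perm A) (x : Univ A) : perm π⁻¹ (perm π x) = x := by
  rw [← perm_mul, inv_mul_cancel, perm_one]

theorem perm_perm_inv (π : Equiv.Perm A) (x : Univ A) : perm π (perm π⁻¹ x) = x := by
  rw [← perm_mul, mul_inv_cancel, perm_one]

theorem mem_perm (π : Equiv.Perm A) {x y : Univ A} (h : Mem x y) :
    Mem (perm π x) (perm π y) := by
  obtain ⟨a, rfl⟩ | ⟨ι, f, rfl⟩ := atom_or_mkSet y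
  · exact (not_mem_atom _ _ h).elim
  · obtain ⟨i, rfl⟩ := mem_mkSet.1 h
    rw [perm_mkSet]
    exact mem_mkSet.2 ⟨i, rfl⟩

/-- The unordered pair `{x, y}`. -/
noncomputable def upair (x y : Univ A) : Univ A :=
  mkSet fun b : ULift.{u} Bool => if b.down then x else y

@[simp] theorem mem_upair {x y z : Univ A} : Mem z (upair x y) ↔ z = x ∨ z = y := by
  simp only [upair, mem_mkSet]
  constructor
  · rintro ⟨⟨_ | _⟩, h⟩
    · exact Or.inr h
    · exact Or.inl h
  · rintro (h | h)
    · exact ⟨⟨true⟩, h⟩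
    · exact ⟨⟨false⟩, h⟩

theorem perm_upair (π : Equiv.Perm A) (x y : Univ A) :
    perm π (upair x y) = upair (perm π x) (perm π y) := by
  simp only [upair, perm_mkSet]
  exact congrArg mkSet (funext fun b => by split_ifs <;> rfl)

/-- The ordered pair `⟨x, y⟩ = {{x}, {x, y}}`. -/
noncomputable def pair (x y : Univ A) : Univ A := upair (upair x x) (upair x y)

theorem perm_pair (π : Equiv.Perm A) (x y : Univ A) :
    perm π (pair x y) = pair (perm π x) (perm π y) := by
  simp only [pair, perm_upair]

theorem upair_eq_upair {x y z w : Univ A} (h : upair x y = upair z w) :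
    x = z ∧ y = w ∨ x = w ∧ y = z := by
  have h' : ∀ t, (t = x ∨ t = y) ↔ (t = z ∨ t = w) := fun t => by
    rw [← mem_upair, h, mem_upair]
  have h1 := (h' x).1 (Or.inl rfl)
  have h2 := (h' y).1 (Or.inr rfl)
  have h3 := (h' z).2 (Or.inl rfl)
  have h4 := (h' w).2 (Or.inr rfl)
  grind

@[simp] theorem pair_inj {x y z w : Univ A} : pair x y = pair z w ↔ x = z ∧ y = w := by
  refine ⟨fun h => ?_, fun ⟨h, h'⟩ => h ▸ h' ▸ rfl⟩
  obtain ⟨h1, h2⟩ | ⟨h1, h2⟩ := upair_eq_upair h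
  · have := upair_eq_upair h1
    have := upair_eq_upair h2
    grind
  · have := upair_eq_upair h1
    have := upair_eq_upair h2
    grind

/-- The natural number `n` as a von Neumann ordinal. -/
noncomputable def nat (n : ℕ) : Univ A :=
  mkSet fun i : ULift.{u} (Fin n) => nat i.down.1
decreasing_by exact i.down.2

@[simp] theorem mem_nat {n : ℕ} {x : Univ A} : Mem x (nat n) ↔ ∃ i < n, x = nat i := by
  rw [nat, mem_mkSet]
  exact ⟨fun ⟨i, h⟩ => ⟨i.down.1, i.down.2, h⟩, fun ⟨i, hi, h⟩ => ⟨⟨⟨i, hi⟩⟩, h⟩⟩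

theorem nat_ne_atom (n : ℕ) (a : A) : nat n ≠ atom a := by
  rw [nat]
  exact mkSet_ne_atom _ a

@[simp] theorem perm_nat (π : Equiv.Perm A) (n : ℕ) : perm π (nat n) = nat n := by
  induction n using Nat.strong_induction_on with
  | _ n ih =>
    rw [nat, perm_mkSet]
    exact congrArg mkSet (funext fun i => ih _ i.down.2)

theorem not_mem_self (x : Univ A) : ¬ Mem x x := by
  induction x using mem_induction with
  | h x ih => exact fun h => ih x h h

@[simp] theorem nat_inj {m n : ℕ} : (nat m : Univ A) = nat n ↔ m = n := by
  refine ⟨fun h => ?_, fun h => h ▸ rfl⟩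
  by_contra hne
  rcases Nat.lt_or_gt_of_ne hne with hlt | hlt
  · exact not_mem_self (nat n) (mem_nat.2 ⟨m, hlt, h.symm⟩)
  · exact not_mem_self (nat m) (mem_nat.2 ⟨n, hlt, h⟩)

/-- The set of atoms `X`, as an object of the universe. -/
noncomputable def ofSet (X : Set A) : Univ A := mkSet fun a : X => atom a.1

@[simp] theorem mem_ofSet {X : Set A} {x : Univ A} : Mem x (ofSet X) ↔ ∃ a ∈ X, x = atom a := by
  simp [ofSet]

@[simp] theorem ofSet_inj {X Y : Set A} : ofSet X = ofSet Y ↔ X = Y := by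
  refine ⟨fun h => Set.ext fun a => ?_, fun h => h ▸ rfl⟩
  have h' : Mem (atom a) (ofSet X) ↔ Mem (atom a) (ofSet Y) := by rw [h]
  simpa using h'

theorem ofSet_ne_atom (X : Set A) (a : A) : ofSet X ≠ atom a := mkSet_ne_atom _ a

theorem perm_ofSet (π : Equiv.Perm A) (X : Set A) : perm π (ofSet X) = ofSet (π '' X) := by
  rw [ofSet, perm_mkSet]
  refine ext (mkSet_ne_atom _) (ofSet_ne_atom _) fun z => ?_
  simp only [mem_mkSet, perm_atom, Subtype.exists, mem_ofSet, Set.exists_mem_image, exists_prop]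

/-- The finite sequence of atoms with the entries of `l`, that is, the set of all pairs `⟨i, l i⟩`.
-/
noncomputable def ofList (l : List A) : Univ A :=
  mkSet fun i : ULift.{u} (Fin l.length) => pair (nat i.down.1) (atom (l.get i.down))

theorem pair_mem_ofList {l : List A} {x y : Univ A} :
    Mem (pair x y) (ofList l) ↔ ∃ i a, l[i]? = some a ∧ x = nat i ∧ y = atom a := by
  simp only [ofList, mem_mkSet, pair_inj]
  constructor
  · rintro ⟨i, h1, h2⟩
    exact ⟨i.down.1, _, by simp, h1, h2⟩
  · rintro ⟨i, a, h, h1, h2⟩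
    obtain ⟨hi, rfl⟩ := List.getElem?_eq_some_iff.1 h
    exact ⟨⟨⟨i, hi⟩⟩, h1, h2⟩

theorem mem_ofList {l : List A} {x : Univ A} :
    Mem x (ofList l) ↔ ∃ i a, l[i]? = some a ∧ x = pair (nat i) (atom a) := by
  constructor
  · intro h
    obtain ⟨i, rfl⟩ := mem_mkSet.1 h
    exact ⟨i.down.1, _, by simp, rfl⟩
  · rintro ⟨i, a, h, rfl⟩
    exact pair_mem_ofList.2 ⟨i, a, h, rfl, rfl⟩

theorem ofList_ne_atom (l : List A) (a : A) : ofList l ≠ atom a := mkSet_ne_atom _ a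

@[simp] theorem ofList_inj {l l' : List A} : ofList l = ofList l' ↔ l = l' := by
  refine ⟨fun h => List.ext_getElem?_iff.2 fun i => Option.ext fun a => ?_, fun h => h ▸ rfl⟩
  have h' : Mem (pair (nat i) (atom a)) (ofList l) ↔ Mem (pair (nat i) (atom a)) (ofList l') := by
    rw [h]
  simpa [pair_mem_ofList] using h'

theorem perm_ofList (π : Equiv.Perm A) (l : List A) : perm π (ofList l) = ofList (l.map π) := by
  rw [ofList, perm_mkSet]
  refine ext (mkSet_ne_atom _) (ofList_ne_atom _) fun z => ?_
  rw [mem_mkSet, mem_ofList]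
  simp only [perm_pair, perm_nat, perm_atom]
  constructor
  · rintro ⟨i, rfl⟩
    exact ⟨i.down.1, _, by simp, rfl⟩
  · rintro ⟨i, a, h, rfl⟩
    obtain ⟨hi, rfl⟩ := List.getElem?_eq_some_iff.1 h
    exact ⟨⟨⟨i, by simpa using hi⟩⟩, by simp⟩

end Univ

end ZFA

namespace ZFA

open Univ

section Symmetric

/-! ### Symmetric objects -/

variable {A : Type u} {G : Subgroup (Equiv.Perm A)}

theorem HereditarilySymmetric.isSymmetric {x : Univ A} (h : HereditarilySymmetric G x) :
    IsSymmetric G x := by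
  cases h; assumption

theorem HereditarilySymmetric.of_mem {x y : Univ A} (h : HereditarilySymmetric G x)
    (hy : Mem y x) : HereditarilySymmetric G y := by
  cases h with
  | intro _ _ h => exact h y hy

theorem isSupport_of_forall_mem {E : Finset A} {x : Univ A} (hx : ∀ a, x ≠ atom a)
    (h : ∀ π ∈ G, (∀ a ∈ E, π a = a) → ∀ y, Mem y x → Mem (perm π y) x) : IsSupport G E x := by
  intro π hπ hE
  refine Univ.ext (fun a ha => ?_) hx fun z => ⟨fun hz => ?_, fun hz => ?_⟩
  · refine hx (π⁻¹ a) ?_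
    rw [← perm_atom, ← ha, perm_inv_perm]
  · -- the set is also closed under the inverse permutation
    have h1 := mem_perm π⁻¹ hz
    rw [perm_inv_perm] at h1
    simpa [perm_perm_inv] using h π hπ hE _ h1
  · have h1 := h π⁻¹ (G.inv_mem hπ)
      (fun a ha => by rw [Equiv.Perm.inv_eq_iff_eq, hE a ha]) z hz
    simpa [perm_perm_inv] using mem_perm π h1

theorem HereditarilySymmetric.atom (a : A) : HereditarilySymmetric G (Univ.atom a) :=
  ⟨_, ⟨{a}, fun π _ h => by simp [h]⟩, fun y hy => (not_mem_atom y a hy).elim⟩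

theorem HereditarilySymmetric.upair {x y : Univ A} (hx : HereditarilySymmetric G x)
    (hy : HereditarilySymmetric G y) : HereditarilySymmetric G (Univ.upair x y) := by
  classical
  obtain ⟨E, hE⟩ := hx.isSymmetric
  obtain ⟨F, hF⟩ := hy.isSymmetric
  refine ⟨_, ⟨E ∪ F, fun π hπ h => ?_⟩, fun z hz => ?_⟩
  · rw [perm_upair, hE π hπ fun a ha => h a (Finset.mem_union_left _ ha),
      hF π hπ fun a ha => h a (Finset.mem_union_right _ ha)]
  · rcases mem_upair.1 hz with rfl | rfl <;> assumption

theorem HereditarilySymmetric.pair {x y : Univ A} (hx : HereditarilySymmetric G x)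
    (hy : HereditarilySymmetric G y) : HereditarilySymmetric G (Univ.pair x y) :=
  (hx.upair hx).upair (hx.upair hy)

theorem HereditarilySymmetric.nat (n : ℕ) : HereditarilySymmetric G (Univ.nat n : Univ A) := by
  induction n using Nat.strong_induction_on with
  | _ n ih =>
    refine ⟨_, ⟨∅, fun π _ _ => perm_nat π n⟩, fun z hz => ?_⟩
    obtain ⟨i, hi, rfl⟩ := mem_nat.1 hz
    exact ih i hi

theorem isSupport_ofList {l : List A} {E : Finset A} (h : ∀ a ∈ l, a ∈ E) :
    IsSupport G E (ofList l) := by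
  intro π _ hE
  rw [perm_ofList, List.map_congr_left (fun a ha => hE a (h a ha)), List.map_id']

theorem HereditarilySymmetric.ofList (l : List A) : HereditarilySymmetric G (Univ.ofList l) := by
  classical
  refine ⟨_, ⟨l.toFinset, isSupport_ofList fun a ha => by simpa using ha⟩, fun z hz => ?_⟩
  obtain ⟨i, a, -, rfl⟩ := mem_ofList.1 hz
  exact (HereditarilySymmetric.nat i).pair (.atom a)

theorem HereditarilySymmetric.ofSet {X : Set A} (h : IsSymmetric G (Univ.ofSet X)) :
    HereditarilySymmetric G (Univ.ofSet X) := by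
  refine ⟨_, h, fun z hz => ?_⟩
  obtain ⟨a, -, rfl⟩ := mem_ofSet.1 hz
  exact .atom a

/-- A set of hereditarily symmetric objects is hereditarily symmetric if it is invariant under the
permutations that fix a finite set of atoms. -/
theorem HereditarilySymmetric.mkSet {ι : Type u} {f : ι → Univ A} (E : Finset A)
    (hf : ∀ i, HereditarilySymmetric G (f i))
    (h : ∀ π ∈ G, (∀ a ∈ E, π a = a) → ∀ i, ∃ j, perm π (f i) = f j) :
    HereditarilySymmetric G (Univ.mkSet f) := by
  refine ⟨_, ⟨E, isSupport_of_forall_mem (mkSet_ne_atom f) fun π hπ hE y hy => ?_⟩, fun z hz => ?_⟩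
  · obtain ⟨i, rfl⟩ := mem_mkSet.1 hy
    exact mem_mkSet.2 (h π hπ hE i)
  · obtain ⟨i, rfl⟩ := mem_mkSet.1 hz
    exact hf i

end Symmetric

section Absoluteness

/-! ### The formulas of set theory in a permutation model -/

variable {A : Type u} {G : Subgroup (Equiv.Perm A)}

/-- The object of the full universe underlying an object of a permutation model. -/
def PermModel.val (x : PermModel G) : Univ A := Subtype.val x

theorem PermModel.hs (x : PermModel G) : HereditarilySymmetric G x.val := Subtype.prop x

/-- A hereditarily symmetric object, as an object of the permutation model. -/
def PermModel.of (x : Univ A) (hx : HereditarilySymmetric G x) : PermModel G := ⟨x, hx⟩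

@[simp] theorem PermModel.val_of (x : Univ A) (hx : HereditarilySymmetric G x) :
    (PermModel.of x hx).val = x := rfl

theorem PermModel.ext {x y : PermModel G} (h : x.val = y.val) : x = y := Subtype.ext h

theorem PermModel.ext_iff {x y : PermModel G} : x = y ↔ x.val = y.val := Subtype.ext_iff

variable {x y z p f n : PermModel G}

theorem mem_def : SetStructure.mem x y ↔ Mem x.val y.val := Iff.rfl

theorem isSet_iff : IsSet x ↔ ∀ a, x.val ≠ atom a := not_exists

theorem PermModel.ext_of_isSet (hx : IsSet x) (hy : ∀ a, y.val ≠ atom a)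
    (h : ∀ z : PermModel G, SetStructure.mem z x ↔ Mem z.val y.val) : x.val = y.val :=
  Univ.ext (isSet_iff.1 hx) hy fun z =>
    ⟨fun hz => (h (.of z (x.hs.of_mem hz))).1 hz, fun hz => (h (.of z (y.hs.of_mem hz))).2 hz⟩

theorem isUnorderedPair_iff : IsUnorderedPair p x y ↔ p.val = upair x.val y.val := by
  constructor
  · rintro ⟨hp, h⟩
    refine PermModel.ext_of_isSet (y := .of _ (x.hs.upair y.hs)) hp (mkSet_ne_atom _) fun z => ?_
    rw [h, PermModel.val_of, mem_upair, PermModel.ext_iff, PermModel.ext_iff]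
  · intro h
    refine ⟨isSet_iff.2 fun a => h ▸ mkSet_ne_atom _ a, fun z => ?_⟩
    rw [mem_def, h, mem_upair, PermModel.ext_iff, PermModel.ext_iff]

theorem isPair_iff : IsPair p x y ↔ p.val = pair x.val y.val := by
  simp only [IsPair, isUnorderedPair_iff]
  exact ⟨fun ⟨s, t, hs, ht, h⟩ => by rw [h, hs, ht]; rfl,
    fun h => ⟨.of _ (x.hs.upair x.hs), .of _ (x.hs.upair y.hs), rfl, rfl, h⟩⟩

theorem maps_iff : Maps f x y ↔ Mem (pair x.val y.val) f.val := by
  simp only [Maps, isPair_iff]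
  exact ⟨fun ⟨p, hp, h⟩ => hp ▸ h, fun h => ⟨.of _ (x.hs.pair y.hs), rfl, h⟩⟩

theorem isNatural_of_eq {k : ℕ} (h : n.val = nat k) : IsNatural n := by
  have hmem : ∀ {y : PermModel G}, SetStructure.mem y n → ∃ i < k, y.val = nat i := fun hy => by
    rwa [mem_def, h, mem_nat] at hy
  have hset : ∀ {y : PermModel G} {i : ℕ}, y.val = nat i → IsSet y := fun hy =>
    isSet_iff.2 fun a => hy ▸ nat_ne_atom _ a
  have hES : ∀ {y : PermModel G} {i : ℕ}, y.val = nat i → IsEmptySet y ∨ IsSuccessor y := by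
    intro y i hy
    rcases i with _ | i
    · refine Or.inl ⟨hset hy, fun z hz => ?_⟩
      rw [mem_def, hy] at hz
      simp at hz
    · refine Or.inr ⟨hset hy, (.of (nat i) (.nat i)), hset rfl, fun z => ?_⟩
      rw [mem_def, mem_def, PermModel.ext_iff, PermModel.val_of, hy, mem_nat, mem_nat]
      constructor
      · rintro ⟨j, hj, h⟩
        rcases Nat.lt_succ_iff_lt_or_eq.1 hj with hj | rfl
        · exact Or.inl ⟨j, hj, h⟩
        · exact Or.inr h
      · rintro (⟨j, hj, h⟩ | h)
        · exact ⟨j, by omega, h⟩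
        · exact ⟨i, by omega, h⟩
  have hlt : ∀ {y z : PermModel G} {i j : ℕ}, y.val = nat i → z.val = nat j →
      (SetStructure.mem y z ↔ i < j) := fun hy hz => by
    rw [mem_def, hy, hz]
    simp
  refine ⟨⟨hset h, fun y hy => ?_, fun y hy => ?_, fun y z w hy hz hw => ?_, fun y z hy hz => ?_,
    fun s hs ⟨y, hy⟩ => ?_⟩, hES h, fun y hy => ?_⟩
  · obtain ⟨i, hi, hyi⟩ := hmem hy
    refine ⟨hset hyi, fun z hz => ?_⟩
    rw [mem_def, hyi, mem_nat] at hz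
    obtain ⟨j, hj, hz⟩ := hz
    rw [mem_def, h, mem_nat]
    exact ⟨j, hj.trans hi, hz⟩
  · exact not_mem_self _
  · obtain ⟨i, -, hi⟩ := hmem hy
    obtain ⟨j, -, hj⟩ := hmem hz
    obtain ⟨l, -, hl⟩ := hmem hw
    rw [hlt hi hj, hlt hj hl, hlt hi hl]
    exact lt_trans
  · obtain ⟨i, -, hi⟩ := hmem hy
    obtain ⟨j, -, hj⟩ := hmem hz
    rw [hlt hi hj, hlt hj hi, PermModel.ext_iff, hi, hj, nat_inj]
    exact lt_trichotomy i j
  · classical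
    have hex : ∃ i, ∃ y : PermModel G, SetStructure.mem y s ∧ y.val = nat i := by
      obtain ⟨i, -, hi⟩ := hmem (hs.2 y hy)
      exact ⟨i, y, hy, hi⟩
    obtain ⟨m, hm, hmi⟩ := Nat.find_spec hex
    refine ⟨m, hm, fun z hz hzm => ?_⟩
    obtain ⟨j, -, hj⟩ := hmem (hs.2 z hz)
    exact Nat.find_min hex ((hlt hj hmi).1 hzm) ⟨z, hz, hj⟩
  · obtain ⟨i, -, hi⟩ := hmem hy
    exact hES hi

/-- The natural numbers of a permutation model are the true ones: membership in the universe is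
well-founded, so the descent from `n` to predecessors reaches the empty set. -/
theorem isNatural_iff : IsNatural n ↔ ∃ k, n.val = nat k := by
  refine ⟨fun ⟨hord, hn, hmem⟩ => ?_, fun ⟨k, h⟩ => isNatural_of_eq h⟩
  have hES : ∀ y : PermModel G, y = n ∨ SetStructure.mem y n → IsEmptySet y ∨ IsSuccessor y := by
    rintro y (rfl | hy)
    · exact hn
    · exact hmem y hy
  have key : ∀ y : Univ A, ∀ hy : HereditarilySymmetric G y,
      (PermModel.of y hy = n ∨ SetStructure.mem (PermModel.of y hy) n) →
      ∃ k, y = nat k := by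
    intro y
    induction y using mem_induction with
    | h y ih =>
      intro hy hyn
      rcases hES _ hyn with ⟨hset, h⟩ | ⟨hset, z, -, h⟩
      · refine ⟨0, PermModel.ext_of_isSet (x := .of y hy) (y := .of (nat 0) (.nat 0)) hset
          (nat_ne_atom 0) fun z => ?_⟩
        simp [h z]
      · have hz : SetStructure.mem z (PermModel.of y hy) := (h z).2 (Or.inr rfl)
        have hzn : SetStructure.mem z n := by
          rcases hyn with rfl | hyn
          · exact hz
          · exact (hord.2.1 _ hyn).2 z hz
        obtain ⟨k, hk⟩ := ih z.val hz z.hs (Or.inr hzn)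
        refine ⟨k + 1, PermModel.ext_of_isSet (x := .of y hy)
          (y := .of (nat (k + 1)) (.nat (k + 1))) hset (nat_ne_atom _) fun w => ?_⟩
        rw [h w, mem_def, PermModel.ext_iff, PermModel.val_of, hk, mem_nat, mem_nat]
        constructor
        · rintro (⟨j, hj, h⟩ | h)
          · exact ⟨j, by omega, h⟩
          · exact ⟨k, by omega, h⟩
        · rintro ⟨j, hj, h⟩
          rcases Nat.lt_succ_iff_lt_or_eq.1 hj with hj | rfl
          · exact Or.inl ⟨j, hj, h⟩
          · exact Or.inr h
  exact key n.val n.hs (Or.inl rfl)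

theorem isSubset_atoms_iff {m : PermModel G} (hm : IsSetOfAtoms m) :
    IsSubset x m ↔ ∃ X : Set A, x.val = ofSet X := by
  have hmem : ∀ z : PermModel G, SetStructure.mem z m ↔ ∃ a, z.val = atom a := hm.2
  constructor
  · rintro ⟨hx, h⟩
    refine ⟨{a | Mem (atom a) x.val}, Univ.ext (isSet_iff.1 hx) (ofSet_ne_atom _) fun z => ?_⟩
    rw [mem_ofSet]
    constructor
    · intro hz
      obtain ⟨a, ha⟩ := (hmem _).1 (h (.of z (x.hs.of_mem hz)) hz)
      obtain rfl : z = atom a := ha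
      exact ⟨a, hz, rfl⟩
    · rintro ⟨a, ha, rfl⟩
      exact ha
  · rintro ⟨X, hX⟩
    refine ⟨isSet_iff.2 fun a => hX ▸ ofSet_ne_atom X a, fun z hz => (hmem z).2 ?_⟩
    rw [mem_def, hX, mem_ofSet] at hz
    obtain ⟨a, -, ha⟩ := hz
    exact ⟨a, ha⟩

theorem isFunction_ofList {m : PermModel G} (hm : IsSetOfAtoms m) {l : List A}
    (hn : n.val = nat l.length) (hf : f.val = ofList l) : IsFunction f n m := by
  have hmem : ∀ z : PermModel G, SetStructure.mem z m ↔ ∃ a, z.val = atom a := hm.2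
  refine ⟨isSet_iff.2 fun a => hf ▸ ofList_ne_atom l a, isSet_iff.2 fun a => hn ▸ nat_ne_atom _ a,
    hm.1, fun p hp => ?_, fun b hb => ?_⟩
  · rw [mem_def, hf, mem_ofList] at hp
    obtain ⟨i, a, hi, hp⟩ := hp
    refine ⟨.of (nat i) (.nat i), .of (atom a) (.atom a), ?_, (hmem _).2 ⟨a, rfl⟩,
      isPair_iff.2 hp⟩
    rw [mem_def, hn, mem_nat]
    exact ⟨i, (List.getElem?_eq_some_iff.1 hi).1, rfl⟩
  · rw [mem_def, hn, mem_nat] at hb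
    obtain ⟨i, hi, hb⟩ := hb
    refine ⟨.of (atom l[i]) (.atom _), ?_, fun c hc => ?_⟩
    · change Maps f b _
      rw [maps_iff, hf, pair_mem_ofList]
      exact ⟨i, _, List.getElem?_eq_getElem hi, hb, rfl⟩
    · change Maps f b c at hc
      rw [maps_iff, hf, pair_mem_ofList] at hc
      obtain ⟨j, a, hj, hb', hc⟩ := hc
      obtain rfl : i = j := nat_inj.1 (hb.symm.trans hb')
      rw [List.getElem?_eq_getElem hi, Option.some_inj] at hj
      exact PermModel.ext (hc.trans (by rw [hj, PermModel.val_of]))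

theorem exists_isFunction_iff {m : PermModel G} (hm : IsSetOfAtoms m) :
    (∃ n, IsNatural n ∧ IsFunction f n m) ↔ ∃ l : List A, f.val = ofList l := by
  have hmem : ∀ z : PermModel G, SetStructure.mem z m ↔ ∃ a, z.val = atom a := hm.2
  constructor
  · rintro ⟨n, hn, hf, -, -, hsub, hfun⟩
    obtain ⟨k, hk⟩ := isNatural_iff.1 hn
    have hval : ∀ i : Fin k, ∃ a : A, ∀ b : PermModel G,
        Maps f (PermModel.of (nat i) (.nat i)) b ↔ b.val = atom a := by
      intro i
      obtain ⟨b, hb, hb'⟩ := hfun (.of (nat i) (.nat i)) (by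
        rw [mem_def, hk, mem_nat]
        exact ⟨i, i.2, rfl⟩)
      obtain ⟨p, hp, hpf⟩ := hb
      obtain ⟨c, d, -, hd, hcd⟩ := hsub p hpf
      obtain ⟨a, ha⟩ := (hmem d).1 hd
      have hbd : b.val = d.val := (pair_inj.1 ((isPair_iff.1 hp).symm.trans (isPair_iff.1 hcd))).2
      refine ⟨a, fun e => ⟨fun he => ?_, fun he => ?_⟩⟩
      · rw [hb' e he, hbd, ha]
      · have : e = b := PermModel.ext (by rw [he, hbd, ha])
        exact this ▸ ⟨p, hp, hpf⟩
    choose a ha using hval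
    refine ⟨List.ofFn a, Univ.ext (isSet_iff.1 hf) (ofList_ne_atom _) fun z => ?_⟩
    rw [mem_ofList]
    constructor
    · intro hz
      obtain ⟨c, d, hc, -, hcd⟩ := hsub (.of z (f.hs.of_mem hz)) hz
      rw [mem_def, hk, mem_nat] at hc
      obtain ⟨i, hi, hc⟩ := hc
      have hd : d.val = atom (a ⟨i, hi⟩) := by
        rw [← ha ⟨i, hi⟩ d]
        refine ⟨.of z (f.hs.of_mem hz), ?_, hz⟩
        rw [isPair_iff] at hcd ⊢
        rw [hcd, hc, PermModel.val_of]
      refine ⟨i, a ⟨i, hi⟩, by simp [hi], ?_⟩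
      rw [← hd, ← hc]
      exact isPair_iff.1 hcd
    · rintro ⟨i, b, hi, rfl⟩
      obtain ⟨hi', rfl⟩ := List.getElem?_eq_some_iff.1 hi
      rw [List.length_ofFn] at hi'
      have := (ha ⟨i, hi'⟩ (.of (atom (a ⟨i, hi'⟩)) (.atom _))).2 rfl
      rw [maps_iff] at this
      simpa using this
  · rintro ⟨l, hl⟩
    exact ⟨.of (nat l.length) (.nat _), isNatural_of_eq rfl, isFunction_ofList hm rfl hl⟩

theorem exists_isInjection_iff {m : PermModel G} (hm : IsSetOfAtoms m) :
    (∃ n, IsNatural n ∧ IsInjection f n m) ↔ ∃ l : List A, l.Nodup ∧ f.val = ofList l := by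
  constructor
  · rintro ⟨n, hn, hf, hinj⟩
    obtain ⟨l, hl⟩ := (exists_isFunction_iff hm).1 ⟨n, hn, hf⟩
    refine ⟨l, List.nodup_iff_injective_get.2 fun i j hij => ?_, hl⟩
    have h := hinj (.of (nat i) (.nat _)) (.of (nat j) (.nat _)) (.of (atom (l.get i)) (.atom _))
    simp only [maps_iff, hl, pair_mem_ofList, PermModel.ext_iff, PermModel.val_of, nat_inj] at h
    exact Fin.ext (h ⟨i, l.get i, by simp, rfl, rfl⟩ ⟨j, l.get j, by simp, rfl, by rw [hij]⟩)
  · rintro ⟨l, hnd, hl⟩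
    refine ⟨.of (nat l.length) (.nat _), isNatural_of_eq rfl, isFunction_ofList hm rfl hl,
      fun x y b hx hy => ?_⟩
    rw [maps_iff, hl, pair_mem_ofList] at hx hy
    obtain ⟨i, a, hi, hx, hb⟩ := hx
    obtain ⟨j, a', hj, hy, hb'⟩ := hy
    obtain rfl : a = a' := atom_inj.1 (hb.symm.trans hb')
    obtain ⟨hi', hi⟩ := List.getElem?_eq_some_iff.1 hi
    obtain ⟨hj', hj⟩ := List.getElem?_eq_some_iff.1 hj
    have : i = j := (hnd.getElem_inj_iff).1 (hi.trans hj.symm)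
    exact PermModel.ext (by rw [hx, hy, this])

/-- An injection of the full universe whose graph has a finite support belongs to the model. -/
theorem cardLE_of_equivariant {ι : Type u} {φ ψ : ι → Univ A} (hx : x.val = mkSet φ) (hy : IsSet y)
    (hφ : Function.Injective φ) (hψ : Function.Injective ψ) (hmem : ∀ i, Mem (ψ i) y.val)
    (E : Finset A)
    (hE : ∀ π ∈ G, (∀ a ∈ E, π a = a) → ∀ i, ∃ j, perm π (φ i) = φ j ∧ perm π (ψ i) = ψ j) :
    CardLE x y := by
  have hxφ : ∀ i, HereditarilySymmetric G (φ i) := fun i =>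
    x.hs.of_mem (by rw [hx]; exact mem_mkSet.2 ⟨i, rfl⟩)
  have hyψ : ∀ i, HereditarilySymmetric G (ψ i) := fun i => y.hs.of_mem (hmem i)
  have hgr : HereditarilySymmetric G (mkSet fun i => pair (φ i) (ψ i)) := by
    refine .mkSet E (fun i => (hxφ i).pair (hyψ i)) fun π hπ h i => ?_
    obtain ⟨j, h1, h2⟩ := hE π hπ h i
    exact ⟨j, by rw [perm_pair, h1, h2]⟩
  have hmaps : ∀ a b : PermModel G, Maps (PermModel.of _ hgr) a b ↔
      ∃ i, a.val = φ i ∧ b.val = ψ i := fun a b => by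
    simp only [maps_iff, PermModel.val_of, mem_mkSet, pair_inj]
  refine ⟨⟨_, hgr⟩, ⟨isSet_iff.2 (mkSet_ne_atom _), isSet_iff.2 fun a => hx ▸ mkSet_ne_atom φ a, hy,
    fun p hp => ?_, fun a ha => ?_⟩, fun a a' b h h' => ?_⟩
  · obtain ⟨i, hi⟩ := mem_mkSet.1 hp
    refine ⟨.of (φ i) (hxφ i), (.of (ψ i) (hyψ i)), ?_, hmem i, isPair_iff.2 hi⟩
    rw [mem_def, hx]
    exact mem_mkSet.2 ⟨i, rfl⟩
  · rw [mem_def, hx, mem_mkSet] at ha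
    obtain ⟨i, hi⟩ := ha
    refine ⟨.of (ψ i) (hyψ i), (hmaps _ _).2 ⟨i, hi, rfl⟩, fun b hb => ?_⟩
    obtain ⟨j, hj, hb⟩ := (hmaps _ _).1 hb
    exact PermModel.ext (by rw [hb, hφ (hj.symm.trans hi), PermModel.val_of])
  · obtain ⟨i, hi, hb⟩ := (hmaps _ _).1 h
    obtain ⟨j, hj, hb'⟩ := (hmaps _ _).1 h'
    exact PermModel.ext (by rw [hi, hj, hψ (hb.symm.trans hb')])

/-- An injection in the model is an injection of the full universe that commutes with all
permutations fixing a finite set of atoms. -/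
theorem CardLE.exists_equivariant (h : CardLE x y) :
    ∃ (E : Finset A) (Φ : Univ A → Univ A), (∀ a, Mem a x.val → Mem (Φ a) y.val) ∧
      (∀ a b, Mem a x.val → Mem b x.val → Φ a = Φ b → a = b) ∧
      ∀ π ∈ G, (∀ a ∈ E, π a = a) → ∀ a, Mem a x.val → Mem (perm π a) x.val →
        Φ (perm π a) = perm π (Φ a) := by
  obtain ⟨f, ⟨hf, hx, hy, hsub, hfun⟩, hinj⟩ := h
  obtain ⟨E, hE⟩ := f.hs.isSymmetric
  have hex : ∀ a, ∃ b, Mem a x.val → Mem (pair a b) f.val := by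
    intro a
    by_cases ha : Mem a x.val
    · obtain ⟨b, hb, -⟩ := hfun (.of a (x.hs.of_mem ha)) ha
      exact ⟨b.val, fun _ => maps_iff.1 hb⟩
    · exact ⟨a, fun h => (ha h).elim⟩
  choose Φ hΦ using hex
  have hmem : ∀ a b, Mem (pair a b) f.val → Mem a x.val ∧ Mem b y.val := by
    intro a b h
    obtain ⟨c, d, hc, hd, hcd⟩ := hsub (.of _ (f.hs.of_mem h)) h
    obtain ⟨h1, h2⟩ := pair_inj.1 (isPair_iff.1 hcd)
    exact ⟨h1 ▸ hc, h2 ▸ hd⟩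
  have huniq : ∀ a b, Mem (pair a b) f.val → b = Φ a := by
    intro a b h
    obtain ⟨ha, hb⟩ := hmem a b h
    have h' := hΦ a ha
    exact congrArg PermModel.val ((hfun (.of a (x.hs.of_mem ha)) ha).unique
      (y₁ := .of b (y.hs.of_mem hb)) (y₂ := (.of (Φ a) (y.hs.of_mem (hmem _ _ h').2)))
      (maps_iff.2 h) (maps_iff.2 h'))
  refine ⟨E, Φ, fun a ha => (hmem _ _ (hΦ a ha)).2, fun a b ha hb hab => ?_,
    fun π hπ hfix a ha _ => ?_⟩
  · have ha' := hΦ a ha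
    have hb' := hΦ b hb
    rw [← hab] at hb'
    exact congrArg PermModel.val (hinj (.of a (x.hs.of_mem ha)) (.of b (x.hs.of_mem hb))
      (.of (Φ a) (y.hs.of_mem (hmem _ _ ha').2)) (maps_iff.2 ha') (maps_iff.2 hb'))
  · refine (huniq _ _ ?_).symm
    rw [← perm_pair, ← hE π hπ hfix]
    exact mem_perm π (hΦ a ha)

end Absoluteness

end ZFA

namespace Categorical

open FirstOrder FirstOrder.Language FirstOrder.Language.Structure

/-! ### Generic structures -/

section Generic

variable {M : Type u} [sig.Structure M] {N : Type v} [sig.Structure N]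

/-- The order relation of a structure. -/
def Less (x y : M) : Prop := RelMap (L := sig) Rel.lt ![x, y]

/-- The relation `R n` of a structure. -/
def Holds (n : ℕ) (z : Fin (n + 1) → M) : Prop := RelMap (L := sig) (Rel.R n) z

/-- The extension property: over a finite set `S`, every cut `lo` of `S` and every choice `P` of the
relations that may hold between a new point and distinct points of `S` is realized by some point.
The pattern `P n i w` speaks of the tuple with the new point at place `i` and `w` at the other
places. -/
def Generic (M : Type u) [sig.Structure M] : Prop :=
  ∀ (S : Finset M) (lo : M → Prop), (∀ a ∈ S, ∀ b ∈ S, Less a b → lo b → lo a) →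
    ∀ P : ∀ n, Fin (n + 1) → (Fin n → M) → Prop,
      ∃ x ∉ S, (∀ s ∈ S, Less s x ↔ lo s) ∧
        ∀ n (i : Fin (n + 1)) (w : Fin n → M), Function.Injective w → (∀ k, w k ∈ S) →
          (Holds n (i.insertNth x w) ↔ P n i w)

/-- `f` restricts to an isomorphism from `S` onto its image. -/
structure IsPartialIso (S : Set N) (f : N → M) : Prop where
  injOn : Set.InjOn f S
  less : ∀ a ∈ S, ∀ b ∈ S, (Less (f a) (f b) ↔ Less a b)
  holds : ∀ n (z : Fin (n + 1) → N), (∀ k, z k ∈ S) → (Holds n (f ∘ z) ↔ Holds n z)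

theorem comp_insertNth {α β : Type*} (f : α → β) {n : ℕ} (i : Fin (n + 1)) (x : α)
    (w : Fin n → α) :
    f ∘ (i.insertNth x w : Fin (n + 1) → α) = (i.insertNth (f x) (f ∘ w) : Fin (n + 1) → β) := by
  funext k
  refine Fin.succAboveCases i ?_ (fun k => ?_) k <;> simp

theorem injective_insertNth {α : Type*} {n : ℕ} {i : Fin (n + 1)} {x : α} {w : Fin n → α}
    (hw : Function.Injective w) (hx : ∀ k, w k ≠ x) :
    Function.Injective (i.insertNth x w : Fin (n + 1) → α) := by
  intro j k
  refine Fin.succAboveCases i ?_ (fun j => ?_) j <;>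
  refine Fin.succAboveCases i ?_ (fun k => ?_) k
  · simp
  · simpa using fun h => (hx k h.symm).elim
  · simpa using hx j
  · simpa using fun h => hw h

theorem IsModel.less_irrefl (hM : IsModel M) (a : M) : ¬ Less a a := by
  have : IsStrictTotalOrder M fun x y => Less x y := hM.1
  exact irrefl_of (fun x y : M => Less x y) a

theorem IsModel.less_trans (hM : IsModel M) {a b c : M} (h : Less a b) (h' : Less b c) :
    Less a c := by
  have : IsStrictTotalOrder M fun x y => Less x y := hM.1
  exact trans_of (fun x y : M => Less x y) h h'

theorem IsModel.less_trichotomy (hM : IsModel M) (a b : M) : Less a b ∨ a = b ∨ Less b a := by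
  have : IsStrictTotalOrder M fun x y => Less x y := hM.1
  exact trichotomous_of (fun x y : M => Less x y) a b

theorem IsModel.less_asymm (hM : IsModel M) {a b : M} (h : Less a b) : ¬ Less b a :=
  fun h' => hM.less_irrefl a (hM.less_trans h h')

theorem IsModel.of_embedding (hM : IsModel M) (e : N ↪[sig] M) : IsModel N := by
  have hless : ∀ a b : N, Less (e a) (e b) ↔ Less a b := fun a b => by
    have := e.map_rel Rel.lt ![a, b]
    rw [show ⇑e ∘ ![a, b] = ![e a, e b] by funext i; fin_cases i <;> rfl] at this
    exact this
  refine ⟨{ trichotomous := fun a b h h' => ?_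
            irrefl := fun a h => ?_
            trans := fun a b c h h' => ?_ }, fun n z hz => ?_⟩
  · rcases hM.less_trichotomy (e a) (e b) with h1 | h1 | h1
    · exact (h ((hless _ _).1 h1)).elim
    · exact e.injective h1
    · exact (h' ((hless _ _).1 h1)).elim
  · exact hM.less_irrefl _ ((hless a a).2 h)
  · exact (hless a c).1 (hM.less_trans ((hless a b).2 h) ((hless b c).2 h'))
  · exact (hM.2 n _ ((e.map_rel (Rel.R n) z).2 hz)).of_comp

/-- A partial isomorphism extends by `m ↦ x` if `x` has the same type over the image as `m` has over
the domain. Tuples with repetitions need no attention, as `R n` never holds of them. -/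
theorem IsPartialIso.update [DecidableEq N] (hN : IsModel N) (hM : IsModel M) {S : Set N}
    {f : N → M} (hf : IsPartialIso S f) {m : N} (hm : m ∉ S) {x : M} (hx : ∀ a ∈ S, f a ≠ x)
    (hlt : ∀ a ∈ S, (Less (f a) x ↔ Less a m))
    (hR : ∀ n (i : Fin (n + 1)) (v : Fin n → N), Function.Injective v → (∀ k, v k ∈ S) →
      (Holds n (i.insertNth x (f ∘ v) : Fin (n + 1) → M) ↔
        Holds n (i.insertNth m v : Fin (n + 1) → N))) :
    IsPartialIso (insert m S) (Function.update f m x) := by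
  have hlt2 : ∀ a ∈ S, (Less x (f a) ↔ Less m a) := by
    intro a ha
    constructor
    · intro h
      rcases hN.less_trichotomy a m with h1 | h1 | h1
      · exact (hM.less_asymm h ((hlt a ha).2 h1)).elim
      · exact (hm (h1 ▸ ha)).elim
      · exact h1
    · intro h
      rcases hM.less_trichotomy (f a) x with h1 | h1 | h1
      · exact (hN.less_asymm h ((hlt a ha).1 h1)).elim
      · exact (hx a ha h1).elim
      · exact h1
  have hu : ∀ a ∈ S, Function.update f m x a = f a := fun a ha =>
    Function.update_of_ne (fun h : a = m => hm (h ▸ ha)) _ _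
  have hinj : Set.InjOn (Function.update f m x) (insert m S) := by
    rintro a (rfl | ha) b (rfl | hb) hab
    · rfl
    · rw [Function.update_self, hu b hb] at hab
      exact (hx b hb hab.symm).elim
    · rw [Function.update_self, hu a ha] at hab
      exact (hx a ha hab).elim
    · rw [hu a ha, hu b hb] at hab
      exact hf.injOn ha hb hab
  refine ⟨hinj, ?_, fun n z hz => ?_⟩
  · rintro a (rfl | ha) b (rfl | hb)
    · simp [hN.less_irrefl, hM.less_irrefl]
    · rw [Function.update_self, hu b hb, hlt2 b hb]
    · rw [Function.update_self, hu a ha, hlt a ha]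
    · rw [hu a ha, hu b hb, hf.less a ha b hb]
  · by_cases hzm : ∃ i, z i = m
    · obtain ⟨i, hi⟩ := hzm
      by_cases hinjz : Function.Injective z
      · -- the tuple is the point `m` inserted into a tuple of points of `S`
        have hv : ∀ k, i.removeNth z k ∈ S := fun k => by
          rcases hz (i.succAbove k) with h | h
          · exact (Fin.succAbove_ne i k (hinjz (h.trans hi.symm))).elim
          · exact h
        have hzi : z = i.insertNth m (i.removeNth z) := by
          rw [← hi, Fin.insertNth_self_removeNth]
        generalize i.removeNth z = v at hv hzi
        subst hzi
        have hvinj : Function.Injective v := fun j k hjk => by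
          have := hinjz (a₁ := i.succAbove j) (a₂ := i.succAbove k) (by simpa using hjk)
          exact Fin.succAbove_right_injective this
        have hfv : Function.update f m x ∘ v = f ∘ v := funext fun k => hu _ (hv k)
        rw [comp_insertNth, Function.update_self, hfv, hR n i v hvinj hv]
      · refine iff_of_false (fun h => hinjz ?_) fun h => hinjz (hN.2 n z h)
        exact (hM.2 n _ h).of_comp
    · have hzS : ∀ k, z k ∈ S := fun k => (hz k).resolve_left fun h => hzm ⟨k, h⟩
      rw [← hf.holds n z hzS, show Function.update f m x ∘ z = f ∘ z from
        funext fun k => hu _ (hzS k)]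

/-- A partial isomorphism between models extends to any further point if the target is generic. -/
theorem IsPartialIso.exists_update [DecidableEq N] (hN : IsModel N) (hM : IsModel M)
    (hG : Generic M) {S : Set N} (hS : S.Finite) {f : N → M} (hf : IsPartialIso S f) {m : N}
    (hm : m ∉ S) : ∃ x, IsPartialIso (insert m S) (Function.update f m x) := by
  classical
  have himg : ∀ a ∈ S, f a ∈ hS.toFinset.image f := fun a ha =>
    Finset.mem_image_of_mem _ (hS.mem_toFinset.2 ha)
  obtain ⟨x, hx, hlt, hR⟩ := hG (hS.toFinset.image f) (fun y => ∃ a ∈ S, f a = y ∧ Less a m)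
    (by
      rintro _ hfa _ - hab ⟨c, hc, rfl, hcm⟩
      obtain ⟨a, ha, rfl⟩ := Finset.mem_image.1 hfa
      rw [hS.mem_toFinset] at ha
      exact ⟨a, ha, rfl, hN.less_trans ((hf.less a ha c hc).1 hab) hcm⟩)
    (fun n i w => ∃ v : Fin n → N, (∀ k, v k ∈ S) ∧ f ∘ v = w ∧
      Holds n (i.insertNth m v : Fin (n + 1) → N))
  refine ⟨x, hf.update hN hM hm (fun a ha h => hx (h ▸ himg a ha)) (fun a ha => ?_)
    fun n i v hvinj hv => ?_⟩
  · rw [hlt _ (himg a ha)]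
    constructor
    · rintro ⟨b, hb, hba, hbm⟩
      rwa [← hf.injOn hb ha hba]
    · exact fun h => ⟨a, ha, rfl, h⟩
  · rw [hR n i (f ∘ v) (fun j k hjk => hvinj (hf.injOn (hv j) (hv k) hjk)) fun k => himg _ (hv k)]
    constructor
    · rintro ⟨v', hv', hvv', h⟩
      have : v' = v := funext fun k => hf.injOn (hv' k) (hv k) (congrFun hvv' k)
      rwa [← this]
    · exact fun h => ⟨v, hv, rfl, h⟩

/-- A partial isomorphism, as an embedding of a substructure. -/
def IsPartialIso.toEmbedding {T : sig.Substructure N} {f : N → M}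
    (hf : IsPartialIso (T : Set N) f) : T ↪[sig] M where
  toFun a := f a
  inj' a b h := Subtype.ext (hf.injOn a.2 b.2 h)
  map_fun' g := isEmptyElim g
  map_rel' {n} r z := by
    cases r with
    | lt =>
      have h := hf.less _ (z 0).2 _ (z 1).2
      unfold Less at h
      rw [← show (Subtype.val ∘ z : Fin 2 → N) = ![(z 0).1, (z 1).1] by
        funext i; fin_cases i <;> rfl] at h
      rw [← show ((fun a : T => f a) ∘ z : Fin 2 → M) = ![f (z 0).1, f (z 1).1] by
        funext i; fin_cases i <;> rfl] at h
      exact h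
    | R n => exact hf.holds n (fun k => (z k).1) fun k => (z k).2

@[simp] theorem IsPartialIso.toEmbedding_apply {T : sig.Substructure N} {f : N → M}
    (hf : IsPartialIso (T : Set N) f) (a : T) : hf.toEmbedding a = f a := rfl

theorem IsPartialIso.of_embedding {T : sig.Substructure N} (e : T ↪[sig] M) {f : N → M}
    (hf : ∀ a : T, f a = e a) : IsPartialIso (T : Set N) f where
  injOn a ha b hb h := by
    have h' : e ⟨a, ha⟩ = e ⟨b, hb⟩ := by rw [← hf, ← hf]; exact h
    exact congrArg Subtype.val (e.injective h')
  less a ha b hb := by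
    have h := e.map_rel Rel.lt ![⟨a, ha⟩, ⟨b, hb⟩]
    rw [show ⇑e ∘ ![(⟨a, ha⟩ : T), ⟨b, hb⟩] = ![f a, f b] by
      funext i; fin_cases i <;> exact (hf _).symm] at h
    rw [Less, h]
    refine iff_of_eq (congrArg (RelMap (M := N) (L := sig) Rel.lt) ?_)
    funext i; fin_cases i <;> rfl
  holds n z hz := by
    have h := e.map_rel (Rel.R n) fun k => (⟨z k, hz k⟩ : T)
    rw [show (⇑e ∘ fun k => (⟨z k, hz k⟩ : T)) = f ∘ z from
      funext fun k => (hf ⟨z k, hz k⟩).symm] at h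
    exact h

/-- A set of points, as a substructure of a structure in a relational signature. -/
def substructureOf (S : Set N) : sig.Substructure N where
  carrier := S
  fun_mem g := isEmptyElim g

theorem isExtensionPair_of_generic (hN : IsModel N) (hM : IsModel M) (hG : Generic M) :
    sig.IsExtensionPair N M := by
  classical
  rintro ⟨f, hfg⟩ m
  by_cases hm : m ∈ f.dom
  · exact ⟨⟨f, hfg⟩, hm, le_rfl⟩
  obtain ⟨x₀, -⟩ := hG ∅ (fun _ => True) (by simp) fun _ _ _ => True
  have hfin : Finite f.dom := hfg.finite
  let g : N → M := fun a => if h : a ∈ f.dom then (f.toEquiv ⟨a, h⟩ : M) else x₀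
  have hg : ∀ a : f.dom, g a = f.toEquiv a := fun a => by simp [g]
  have hiso : IsPartialIso (f.dom : Set N) g := IsPartialIso.of_embedding f.toEmbedding hg
  obtain ⟨x, hx⟩ := hiso.exists_update hN hM hG (S := (f.dom : Set N)) hfin hm
  let T : sig.Substructure N := substructureOf (insert m (f.dom : Set N))
  have hT : Finite T := (Set.Finite.insert m (s := (f.dom : Set N)) hfin)
  let e : T ↪[sig] M := IsPartialIso.toEmbedding (T := T) hx
  have hle : f.dom ≤ T := fun a ha => Or.inr ha
  refine ⟨⟨⟨T, e.toHom.range, e.equivRange⟩, Substructure.FG.of_finite⟩, Or.inl rfl, hle, ?_⟩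
  ext a
  have ha : (a : N) ≠ m := fun h => hm (h ▸ a.2)
  have he : e (Substructure.inclusion hle a) = (f.toEquiv a : M) := by
    refine (IsPartialIso.toEmbedding_apply (T := T) hx _).trans ?_
    change Function.update g m x (a : N) = _
    rw [Function.update_of_ne ha, hg]
  exact he

/-- The extension property passes along isomorphisms. -/
theorem Generic.of_equiv (hG : Generic M) (e : N ≃[sig] M) : Generic N := by
  classical
  have hless : ∀ a b : N, Less (e a) (e b) ↔ Less a b := fun a b => by
    have := e.map_rel Rel.lt ![a, b]
    rw [show ⇑e ∘ ![a, b] = ![e a, e b] by funext i; fin_cases i <;> rfl] at this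
    exact this
  intro S lo hlo P
  obtain ⟨x, hx, hlt, hR⟩ := hG (S.image e) (fun y => lo (e.symm y))
    (by
      intro _ hea _ heb hab
      obtain ⟨a, ha, rfl⟩ := Finset.mem_image.1 hea
      obtain ⟨b, hb, rfl⟩ := Finset.mem_image.1 heb
      simpa using hlo a ha b hb ((hless a b).1 hab))
    (fun n i w => P n i (e.symm ∘ w))
  refine ⟨e.symm x, fun h => hx (Finset.mem_image.2 ⟨_, h, by simp⟩), fun s hs => ?_,
    fun n i w hw hS => ?_⟩
  · rw [← hless, e.apply_symm_apply, hlt _ (Finset.mem_image_of_mem _ hs), e.symm_apply_apply]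
  · have h := hR n i (e ∘ w) (e.injective.comp hw) fun k => Finset.mem_image_of_mem _ (hS k)
    have h2 : e.symm ∘ e ∘ w = w := funext fun k => e.symm_apply_apply _
    rw [h2] at h
    rw [← h, ← e.apply_symm_apply x, ← comp_insertNth e, e.apply_symm_apply]
    exact (e.map_rel (Rel.R n) _).symm

end Generic

/-! ### A countable generic structure -/

section Construction

/-- Every nonpositive integer is the `2`-adic valuation of a rational number in any given interval.
-/
theorem exists_between_padicValRat_eq {a b : ℚ} (hab : a < b) (k : ℕ) :
    ∃ x, a < x ∧ x < b ∧ padicValRat 2 x = -k := by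
  -- approximate by odd multiples of `1 / (2 ^ k * N)` with `N` odd and large
  obtain ⟨n, hn⟩ := exists_nat_gt (4 / (b - a))
  have hba : 0 < b - a := sub_pos.2 hab
  set D : ℚ := 2 ^ k * (2 * n + 1 : ℕ) with hD
  have hDn : (n : ℚ) ≤ D := by
    have h1 : (1 : ℚ) ≤ 2 ^ k := one_le_pow₀ (by norm_num)
    have h2 : (n : ℚ) ≤ (2 * n + 1 : ℕ) := by push_cast; linarith [n.cast_nonneg (α := ℚ)]
    have h3 : (0 : ℚ) ≤ (2 * n + 1 : ℕ) := Nat.cast_nonneg _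
    nlinarith
  have hD0 : 0 < D := by positivity
  have hgap : 4 < (b - a) * D := by
    have := (div_lt_iff₀ hba).1 (hn.trans_le hDn)
    linarith
  set t : ℤ := ⌊a * D / 2⌋ + 1 with ht
  have h1 : a * D / 2 < t := by rw [ht]; push_cast; exact Int.lt_floor_add_one _
  have h2 : (t : ℚ) ≤ a * D / 2 + 1 := by
    rw [ht]; push_cast; linarith [Int.floor_le (a * D / 2)]
  refine ⟨((2 * t + 1 : ℤ) : ℚ) / D, ?_, ?_, ?_⟩
  · rw [lt_div_iff₀ hD0]
    push_cast
    linarith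
  · rw [div_lt_iff₀ hD0]
    push_cast
    linarith
  · have : Fact (Nat.Prime 2) := ⟨Nat.prime_two⟩
    have hodd : ((2 * t + 1 : ℤ) : ℚ) ≠ 0 := by
      rw [Int.cast_ne_zero]; omega
    rw [padicValRat.div hodd hD0.ne', padicValRat.of_int,
      padicValInt.eq_zero_of_not_dvd (by omega), hD, padicValRat.mul (by positivity)
      (by positivity), padicValRat.pow (q := 2), padicValRat.of_nat,
      padicValNat.eq_zero_of_not_dvd (by omega)]
    have : padicValRat 2 (2 : ℚ) = 1 := padicValRat.self (by norm_num)
    simp [this]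

/-- The rationals split into dense sets indexed by any given nonempty countable type. -/
theorem exists_dense_coloring (C : Type u) [Countable C] [Nonempty C] :
    ∃ c : ℚ → C, ∀ a b : ℚ, a < b → ∀ t, {x | a < x ∧ x < b ∧ c x = t}.Infinite := by
  obtain ⟨g, hg⟩ := exists_surjective_nat (C × ℕ)
  refine ⟨fun x => (g (-padicValRat 2 x).toNat).1, fun a b hab t => ?_⟩
  have h : ∀ j : ℕ, ∃ x, (a < x ∧ x < b) ∧ g (-padicValRat 2 x).toNat = (t, j) := fun j => by
    obtain ⟨k, hk⟩ := hg (t, j)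
    obtain ⟨x, h1, h2, h3⟩ := exists_between_padicValRat_eq hab k
    exact ⟨x, ⟨h1, h2⟩, by simp [h3, hk]⟩
  choose x hx hxg using h
  refine Set.infinite_of_injective_forall_mem (f := x) (fun i j hij => ?_)
    fun j => ⟨(hx j).1, (hx j).2, congrArg Prod.fst (hxg j)⟩
  have := hxg i
  rw [hij, hxg j] at this
  exact (Prod.ext_iff.1 this).2.symm

/-- A tuple with one place left open. -/
abbrev Pattern (M : Type u) : Type u := Σ n : ℕ, Fin (n + 1) × (Fin n → M)

theorem finite_patterns {M : Type u} (S : Finset M) :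
    {p : Pattern M | Function.Injective p.2.2 ∧ ∀ k, p.2.2 k ∈ S}.Finite := by
  refine (Set.finite_range (fun q : Σ n : Fin (S.card + 1), Fin ((n : ℕ) + 1) × (Fin n → S) =>
    (⟨q.1, q.2.1, fun k => q.2.2 k⟩ : Pattern M))).subset ?_
  rintro ⟨n, i, w⟩ ⟨hw, hS⟩
  have hn : n ≤ S.card := by
    simpa using Finset.card_le_card_of_injOn (s := Finset.univ) (t := S) w (fun k _ => hS k)
      hw.injOn
  exact ⟨⟨⟨n, by omega⟩, i, fun k => ⟨w k, hS k⟩⟩, rfl⟩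

/-- The rational numbers, as the domain of a generic structure. -/
def RatModel : Type u := ULift.{u} ℚ

instance : Countable RatModel.{u} := inferInstanceAs (Countable (ULift ℚ))

/-- The rational number of a point. -/
def RatModel.rat (x : RatModel.{u}) : ℚ := ULift.down x

theorem RatModel.rat_injective : Function.Injective RatModel.rat.{u} := ULift.down_injective

/-- A coloring of the rationals, with dense color classes, by finite sets of patterns. -/
noncomputable def RatModel.code : ℚ → Finset (Pattern RatModel.{u}) :=
  (exists_dense_coloring (Finset (Pattern RatModel.{u}))).choose

theorem RatModel.infinite_code {a b : ℚ} (hab : a < b) (t : Finset (Pattern RatModel.{u})) :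
    {x | a < x ∧ x < b ∧ RatModel.code x = t}.Infinite :=
  (exists_dense_coloring (Finset (Pattern RatModel.{u}))).choose_spec a b hab t

/-- A tuple of distinct rationals is in `R n` if its entry that comes last in an enumeration of the
rationals lists, by its color, the pattern formed by the other entries. -/
noncomputable instance RatModel.instStructure : sig.Structure RatModel.{u} where
  funMap f := isEmptyElim f
  RelMap r := match r with
    | Rel.lt => fun z => (z 0).rat < (z 1).rat
    | Rel.R n => fun z => Function.Injective z ∧ ∃ i : Fin (n + 1),
        (∀ k, k ≠ i → Encodable.encode (z k).rat < Encodable.encode (z i).rat) ∧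
        (⟨n, i, i.removeNth z⟩ : Pattern RatModel.{u}) ∈ RatModel.code (z i).rat

theorem RatModel.isModel : IsModel RatModel.{u} :=
  ⟨{ trichotomous := fun _ _ h h' => RatModel.rat_injective (le_antisymm (not_lt.1 h') (not_lt.1 h))
     irrefl := fun a => lt_irrefl a.rat
     trans := fun _ _ _ h h' => lt_trans (α := ℚ) h h' }, fun _ _ h => h.1⟩

theorem RatModel.generic : Generic RatModel.{u} := by
  classical
  intro S lo hlo P
  have hcut : ∀ x ∈ (S.filter lo).image rat, ∀ y ∈ (S.filter fun s => ¬ lo s).image rat, x < y := by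
    simp only [Finset.mem_image, Finset.mem_filter]
    rintro _ ⟨a, ⟨ha, hla⟩, rfl⟩ _ ⟨b, ⟨hb, hlb⟩, rfl⟩
    refine lt_of_le_of_ne (not_lt.1 fun h => hlb (hlo b hb a ha h hla)) fun h => hlb ?_
    rwa [← rat_injective h]
  obtain ⟨p, hp1, hp2⟩ := Order.exists_between_finsets _ _ hcut
  obtain ⟨q, hq1, hq2⟩ := Order.exists_between_finsets (insert p ((S.filter lo).image rat))
    ((S.filter fun s => ¬ lo s).image rat) (by
      intro x hx y hy
      rcases Finset.mem_insert.1 hx with rfl | hx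
      · exact hp2 y hy
      · exact hcut x hx y hy)
  have hpq : p < q := hq1 p (Finset.mem_insert_self _ _)
  have hfin : {t : Pattern RatModel.{u} | (Function.Injective t.2.2 ∧ ∀ k, t.2.2 k ∈ S) ∧
      P t.1 t.2.1 t.2.2}.Finite := (finite_patterns S).subset fun t ht => ht.1
  -- the new point comes after all points of `S` in the enumeration
  obtain ⟨x, ⟨hpx, hxq, hcode⟩, hrank⟩ := (infinite_code hpq hfin.toFinset).exists_notMem_finite
    (t := {x : ℚ | Encodable.encode x ≤ S.sup fun s => Encodable.encode s.rat})
    ((Set.finite_Iic _).preimage Encodable.encode_injective.injOn)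
  have hrank : ∀ s ∈ S, Encodable.encode s.rat < Encodable.encode x := fun s hs =>
    (Finset.le_sup (f := fun s : RatModel => Encodable.encode s.rat) hs).trans_lt (not_le.1 hrank)
  refine ⟨(⟨x⟩ : ULift ℚ), fun h => lt_irrefl _ (hrank _ h), fun s hs => ?_, fun n i w hw hS => ?_⟩
  · change s.rat < x ↔ lo s
    constructor
    · intro h
      by_contra hl
      exact lt_asymm (h.trans hxq) (hq2 _ (Finset.mem_image_of_mem _
        (Finset.mem_filter.2 ⟨hs, hl⟩)))
    · intro hl
      exact (hp1 _ (Finset.mem_image_of_mem _ (Finset.mem_filter.2 ⟨hs, hl⟩))).trans hpx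
  · set X : RatModel := (⟨x⟩ : ULift ℚ) with hX
    have hXx : X.rat = x := rfl
    have hmem : (⟨n, i, w⟩ : Pattern RatModel) ∈ code x ↔ P n i w := by
      rw [hcode, Set.Finite.mem_toFinset]
      exact ⟨fun h => h.2, fun h => ⟨⟨hw, hS⟩, h⟩⟩
    rw [← hmem]
    constructor
    · rintro ⟨-, j, hj, h⟩
      obtain rfl : j = i := by
        by_contra hne
        obtain ⟨k, rfl⟩ := Fin.exists_succAbove_eq hne
        have := hj i (Ne.symm hne)
        rw [Fin.insertNth_apply_same, Fin.insertNth_apply_succAbove] at this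
        exact lt_asymm this (hrank _ (hS k))
      rwa [Fin.removeNth_insertNth, Fin.insertNth_apply_same] at h
    · intro h
      refine ⟨injective_insertNth hw fun k hk => ?_, i, fun k hk => ?_, ?_⟩
      · have := hrank _ (hS k)
        rw [hk] at this
        exact lt_irrefl _ this
      · obtain ⟨k, rfl⟩ := Fin.exists_succAbove_eq hk
        rw [Fin.insertNth_apply_same, Fin.insertNth_apply_succAbove]
        exact hrank _ (hS k)
      · rwa [Fin.removeNth_insertNth, Fin.insertNth_apply_same]

theorem isFraisseLimit_of_generic {M : Type u} [sig.Structure M] [Countable M] (hM : IsModel M)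
    (hG : Generic M) : IsFraisseLimit finModels.{u} M where
  ultrahomogeneous := (isUltrahomogeneous_iff_IsExtensionPair Structure.cg_of_countable).2
    (isExtensionPair_of_generic hM hM hG)
  age := by
    ext N
    refine ⟨fun ⟨hfg, ⟨e⟩⟩ => ⟨hfg, hM.of_embedding e⟩, fun ⟨hfg, hN⟩ => ⟨hfg, ?_⟩⟩
    have : IsEmpty sig.Constants := inferInstanceAs (IsEmpty Empty)
    have : IsEmpty (sig.Relations 0) := ⟨fun r => by cases r⟩
    obtain ⟨e, -⟩ := embedding_from_cg hfg.cg default (isExtensionPair_of_generic hN hM hG)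
    exact ⟨e⟩

end Construction

/-! ### Homogeneity of the Fraïssé limit -/

section Limit

variable {M : Type u} [sig.Structure M]

theorem isModel_and_generic [Countable M] (h : IsFraisseLimit finModels.{u} M) :
    IsModel M ∧ Generic M := by
  obtain ⟨e⟩ := h.nonempty_equiv
    (isFraisseLimit_of_generic RatModel.isModel.{u} RatModel.generic.{u})
  exact ⟨RatModel.isModel.of_embedding e.toEmbedding, RatModel.generic.of_equiv e⟩

theorem exists_mem_autGroup (h : IsUltrahomogeneous sig M) {S : Finset M} {f : M → M}
    (hf : IsPartialIso (S : Set M) f) : ∃ π ∈ autGroup M, ∀ s ∈ S, π s = f s := by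
  let T : sig.Substructure M := substructureOf (S : Set M)
  have hT : Finite T := S.finite_toSet
  obtain ⟨g, hg⟩ := h T Substructure.FG.of_finite (IsPartialIso.toEmbedding (T := T) hf)
  refine ⟨g.toEquiv, fun n r x => g.map_rel r x, fun s hs => ?_⟩
  exact (DFunLike.congr_fun hg ⟨s, hs⟩).symm

end Limit

end Categorical

namespace Categorical

open FirstOrder FirstOrder.Language FirstOrder.Language.Structure

/-! ### Types over finite sets -/

section Types

variable {M : Type u} [sig.Structure M]

/-- A homogeneous generic model of the theory. -/
structure IsHomogeneousGeneric (M : Type u) [sig.Structure M] : Prop where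
  isModel : IsModel M
  generic : Generic M
  homogeneous : IsUltrahomogeneous sig M

theorem isHomogeneousGeneric [Countable M] (h : IsFraisseLimit finModels.{u} M) :
    IsHomogeneousGeneric M :=
  ⟨(isModel_and_generic h).1, (isModel_and_generic h).2, h.ultrahomogeneous⟩

/-- `a` and `b` stand in the same relations to the points of `E`. For points outside `E` this means
that they have the same type over `E`. -/
structure SameType (E : Finset M) (a b : M) : Prop where
  less : ∀ e ∈ E, (Less e a ↔ Less e b)
  holds : ∀ n (i : Fin (n + 1)) (w : Fin n → M), Function.Injective w → (∀ k, w k ∈ E) →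
    (Holds n (i.insertNth a w : Fin (n + 1) → M) ↔ Holds n (i.insertNth b w : Fin (n + 1) → M))

theorem SameType.refl (E : Finset M) (a : M) : SameType E a a :=
  ⟨fun _ _ => Iff.rfl, fun _ _ _ _ _ => Iff.rfl⟩

theorem SameType.symm {E : Finset M} {a b : M} (h : SameType E a b) : SameType E b a :=
  ⟨fun e he => (h.less e he).symm, fun n i w hw hE => (h.holds n i w hw hE).symm⟩

theorem SameType.trans {E : Finset M} {a b c : M} (h : SameType E a b) (h' : SameType E b c) :
    SameType E a c :=
  ⟨fun e he => (h.less e he).trans (h'.less e he),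
    fun n i w hw hE => (h.holds n i w hw hE).trans (h'.holds n i w hw hE)⟩

theorem SameType.mono {E F : Finset M} {a b : M} (h : SameType F a b) (hEF : E ⊆ F) :
    SameType E a b :=
  ⟨fun e he => h.less e (hEF he), fun n i w hw hE => h.holds n i w hw fun k => hEF (hE k)⟩

theorem less_apply_iff {π : Equiv.Perm M} (hπ : π ∈ autGroup M) (a b : M) :
    Less (π a) (π b) ↔ Less a b := by
  have h := hπ 2 Rel.lt ![a, b]
  rw [show ⇑π ∘ ![a, b] = ![π a, π b] by funext i; fin_cases i <;> rfl] at h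
  exact h

theorem holds_comp_iff {π : Equiv.Perm M} (hπ : π ∈ autGroup M) {n : ℕ} (z : Fin (n + 1) → M) :
    Holds n (π ∘ z) ↔ Holds n z := hπ (n + 1) (Rel.R n) z

theorem sameType_apply {π : Equiv.Perm M} (hπ : π ∈ autGroup M) {E : Finset M}
    (hE : ∀ e ∈ E, π e = e) (a : M) : SameType E a (π a) := by
  refine ⟨fun e he => ?_, fun n i w _ hw => ?_⟩
  · rw [← less_apply_iff hπ, hE e he]
  · rw [← holds_comp_iff hπ, comp_insertNth, show ⇑π ∘ w = w from funext fun k => hE _ (hw k)]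

/-- Points of the same type over a finite set are conjugate over it. -/
theorem SameType.exists_perm (h : IsHomogeneousGeneric M) {E : Finset M} {a b : M}
    (hab : SameType E a b) (ha : a ∉ E) (hb : b ∉ E) :
    ∃ π ∈ autGroup M, (∀ e ∈ E, π e = e) ∧ π a = b := by
  classical
  have hid : IsPartialIso (E : Set M) (id : M → M) :=
    ⟨Set.injOn_id _, fun _ _ _ _ => Iff.rfl, fun _ _ _ => Iff.rfl⟩
  have hiso := hid.update h.isModel h.isModel (m := a) (x := b) ha
    (fun e he hh => hb (hh ▸ he)) (fun e he => (hab.less e he).symm)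
    fun n i v hv hE => (hab.holds n i v hv hE).symm
  rw [← Finset.coe_insert] at hiso
  obtain ⟨π, hπ, hfix⟩ := exists_mem_autGroup h.homogeneous hiso
  refine ⟨π, hπ, fun e he => ?_, ?_⟩
  · rw [hfix e (Finset.mem_insert_of_mem he),
      Function.update_of_ne (fun hh : e = a => ha (hh ▸ he)), id]
  · rw [hfix a (Finset.mem_insert_self _ _), Function.update_self]

/-- Above any point `a` of a finite set there is a new point that has the same type as `a` over the
rest of the set. -/
theorem exists_greater_sameType [DecidableEq M] (h : IsHomogeneousGeneric M) (S : Finset M) {a : M}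
    (ha : a ∈ S) : ∃ b ∉ S, Less a b ∧ SameType (S.erase a) a b := by
  obtain ⟨b, hb, hlt, hR⟩ := h.generic S (fun s => s = a ∨ Less s a)
    (fun s _ t _ hst ht => by
      rcases ht with rfl | ht
      · exact Or.inr hst
      · exact Or.inr (h.isModel.less_trans hst ht))
    (fun n i w => Holds n (i.insertNth a w : Fin (n + 1) → M))
  refine ⟨b, hb, (hlt a ha).2 (Or.inl rfl), fun e he => ?_, fun n i w hw hE => ?_⟩
  · rw [hlt e (Finset.mem_of_mem_erase he), or_iff_right (Finset.ne_of_mem_erase he)]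
  · rw [hR n i w hw fun k => Finset.mem_of_mem_erase (hE k)]

/-- A point outside a finite set is moved by some automorphism that fixes the set. -/
theorem exists_perm_apply_ne (h : IsHomogeneousGeneric M) {E : Finset M} {a : M} (ha : a ∉ E) :
    ∃ π ∈ autGroup M, (∀ e ∈ E, π e = e) ∧ π a ≠ a := by
  classical
  obtain ⟨b, hb, -, hab⟩ := exists_greater_sameType h (insert a E) (Finset.mem_insert_self a E)
  rw [Finset.erase_insert ha] at hab
  obtain ⟨π, hπ, hE, rfl⟩ := hab.exists_perm h ha fun hbE => hb (Finset.mem_insert_of_mem hbE)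
  exact ⟨π, hπ, hE, fun hh => hb (by rw [hh]; exact Finset.mem_insert_self _ _)⟩

end Types

/-! ### Supports of sets of points -/

section Supports

theorem image_eq_of_mem_iff {α : Type*} {π : Equiv.Perm α} {X : Set α} (h : ∀ a, π a ∈ X ↔ a ∈ X) :
    π '' X = X := by
  ext a
  rw [Equiv.image_eq_preimage_symm, Set.mem_preimage, ← h, Equiv.apply_symm_apply]

variable {M : Type u} [sig.Structure M]

/-- `E` is a support of the set `X`. -/
def Supports (E : Finset M) (X : Set M) : Prop :=
  ∀ π ∈ autGroup M, (∀ e ∈ E, π e = e) → ∀ a, π a ∈ X ↔ a ∈ X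

theorem Supports.mono {E F : Finset M} {X : Set M} (h : Supports E X) (hEF : E ⊆ F) :
    Supports F X := fun π hπ hF => h π hπ fun e he => hF e (hEF he)

theorem Supports.image {E : Finset M} {X : Set M} (h : Supports E X) {π : Equiv.Perm M}
    (hπ : π ∈ autGroup M) : Supports (E.map π.toEmbedding) (π '' X) := by
  intro ρ hρ hfix a
  have h1 := h (π⁻¹ * ρ * π) (mul_mem (mul_mem (inv_mem hπ) hρ) hπ)
    (fun e he => by
      rw [Equiv.Perm.mul_apply, Equiv.Perm.mul_apply,
        hfix (π e) (Finset.mem_map_of_mem π.toEmbedding he)]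
      exact π.symm_apply_apply e) (π.symm a)
  rw [Equiv.Perm.mul_apply, Equiv.Perm.mul_apply, Equiv.apply_symm_apply] at h1
  rw [Equiv.image_eq_preimage_symm]
  exact h1

theorem Supports.mem_iff (h : IsHomogeneousGeneric M) {E : Finset M} {X : Set M}
    (hX : Supports E X) {a b : M} (ha : a ∉ E) (hb : b ∉ E) (hab : SameType E a b) :
    a ∈ X ↔ b ∈ X := by
  obtain ⟨π, hπ, hE, rfl⟩ := hab.exists_perm h ha hb
  exact (hX π hπ hE a).symm

theorem supports_of_sameType {E : Finset M} {X : Set M}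
    (h : ∀ a ∉ E, ∀ b ∉ E, SameType E a b → (a ∈ X ↔ b ∈ X)) : Supports E X := by
  intro π hπ hE a
  by_cases ha : a ∈ E
  · rw [hE a ha]
  · refine (h a ha (π a) (fun hh => ha ?_) (sameType_apply hπ hE a)).symm
    have : π (π a) = π a := hE _ hh
    rwa [← π.injective this]

/-- If `e` lies in one support of `X` but not in another one, it may be moved to a point `e'` above
it, so that `E.erase e` becomes a support when either of `e` and `e'` is added to it. Points `a` and
`b` of the same type over `E.erase e` are then linked by a point `c` that looks like `a` from `e'`
and like `b` from `e`. -/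
theorem Supports.erase [DecidableEq M] (h : IsHomogeneousGeneric M) {E F : Finset M} {X : Set M}
    (hE : Supports E X) (hF : Supports F X) {e : M} (heE : e ∈ E) (heF : e ∉ F) :
    Supports (E.erase e) X := by
  have hM := h.isModel
  -- a new point above `e` with the same type over the other points
  have hnew : ∀ B : Finset M, ∃ e' ∉ E, e' ∉ B ∧ SameType (E.erase e) e e' ∧
      Less e e' ∧ (e ∈ X ↔ e' ∈ X) ∧ Supports (insert e' (E.erase e)) X := by
    intro B
    have heS : e ∈ E ∪ F ∪ B := by simp [heE]
    obtain ⟨e', he', hlt, hst⟩ := exists_greater_sameType h (E ∪ F ∪ B) heS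
    simp only [Finset.mem_union, not_or] at he'
    obtain ⟨π, hπ, hfix, hπe⟩ := hst.exists_perm h (Finset.notMem_erase _ _) fun hh => by
      simpa [he'] using Finset.mem_of_mem_erase hh
    have hπX : ∀ a, π a ∈ X ↔ a ∈ X := hF π hπ fun f hf =>
      hfix f (Finset.mem_erase.2 ⟨fun hh => heF (hh ▸ hf), by simp [hf]⟩)
    have hsub : E.erase e ⊆ (E ∪ F ∪ B).erase e :=
      Finset.erase_subset_erase _ (Finset.subset_union_left.trans Finset.subset_union_left)
    refine ⟨e', he'.1.1, he'.2, hst.mono hsub, hlt, ?_, ?_⟩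
    · rw [← hπe, hπX]
    · have himg := hE.image hπ
      rw [image_eq_of_mem_iff hπX] at himg
      refine himg.mono fun x hx => ?_
      obtain ⟨y, hy, rfl⟩ := Finset.mem_map.1 hx
      by_cases hye : y = e
      · subst hye
        exact Finset.mem_insert.2 (Or.inl hπe)
      · have hyE : y ∈ E.erase e := Finset.mem_erase.2 ⟨hye, hy⟩
        refine Finset.mem_insert_of_mem ?_
        change π y ∈ _
        rwa [hfix y (hsub hyE)]
  have key : ∀ a ∉ E, ∀ b ∉ E, SameType (E.erase e) a b → (Less e a → Less e b) →
      (a ∈ X ↔ b ∈ X) := by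
    intro a ha b hb hab hcut
    obtain ⟨e', he'E, he'B, -, hee', -, hE'⟩ := hnew {a, b}
    simp only [Finset.mem_insert, Finset.mem_singleton, not_or] at he'B
    have he'lt : ¬ Less e' e := hM.less_asymm hee'
    have hne : ∀ s ∈ insert e' (E.erase e), s ≠ e := fun s hs hh => by
      rcases Finset.mem_insert.1 hs with rfl | hs
      · exact he'E (hh ▸ heE)
      · exact Finset.ne_of_mem_erase hs hh
    -- `c` lies on the same side of `e'` as `a` and on the same side of `e` as `b`; these demands on
    -- its cut are consistent by `hcut` and because `e < e'`
    obtain ⟨c, hc, hclt, hcR⟩ := h.generic (insert e (insert e' (E.erase e)))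
      (fun s => (s = e ∧ Less e b) ∨ (s ≠ e ∧ Less s a))
      (by
        rintro s hs t ht hst hlo
        rw [Finset.mem_insert] at hs ht
        rcases hs with rfl | hs
        · refine Or.inl ⟨rfl, ?_⟩
          rcases hlo with ⟨-, hlo⟩ | ⟨-, hlo⟩
          · exact hlo
          · exact hcut (hM.less_trans hst hlo)
        · refine Or.inr ⟨hne s hs, ?_⟩
          rcases hlo with ⟨rfl, hlo⟩ | ⟨-, hlo⟩
          · rcases Finset.mem_insert.1 hs with rfl | hs
            · exact (he'lt hst).elim
            · exact (hab.less s hs).2 (hM.less_trans hst hlo)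
          · exact hM.less_trans hst hlo)
      (fun n i w => (∃ k, w k = e') ∧ Holds n (i.insertNth a w : Fin (n + 1) → M) ∨
        (¬ ∃ k, w k = e') ∧ Holds n (i.insertNth b w : Fin (n + 1) → M))
    have hcE' : c ∉ insert e' (E.erase e) := fun hh => hc (Finset.mem_insert_of_mem hh)
    have hcE : c ∉ E := fun hh => hc (by
      by_cases hce : c = e
      · exact Finset.mem_insert.2 (Or.inl hce)
      · exact Finset.mem_insert_of_mem (Finset.mem_insert_of_mem (Finset.mem_erase.2 ⟨hce, hh⟩)))
    have hac : SameType (insert e' (E.erase e)) a c := by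
      refine ⟨fun s hs => ?_, fun n i w hw hS => ?_⟩
      · rw [hclt s (Finset.mem_insert_of_mem hs)]
        simp [hne s hs]
      · rw [hcR n i w hw fun k => Finset.mem_insert_of_mem (hS k)]
        by_cases hk : ∃ k, w k = e'
        · simp [hk]
        · rw [hab.holds n i w hw fun k =>
            (Finset.mem_insert.1 (hS k)).resolve_left fun hh => hk ⟨k, hh⟩]
          simp only [hk, false_and, not_false_eq_true, true_and, false_or]
    have hbc : SameType E b c := by
      refine ⟨fun s hs => ?_, fun n i w hw hS => ?_⟩
      · by_cases hse : s = e
        · subst hse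
          rw [hclt s (Finset.mem_insert_self _ _)]
          simp
        · have hs' : s ∈ E.erase e := Finset.mem_erase.2 ⟨hse, hs⟩
          rw [hclt s (Finset.mem_insert_of_mem (Finset.mem_insert_of_mem hs')), ← hab.less s hs']
          simp [hse]
      · have hk : ¬ ∃ k, w k = e' := fun ⟨k, hk⟩ => he'E (hk ▸ hS k)
        rw [hcR n i w hw fun k => ?_]
        · simp only [hk, false_and, not_false_eq_true, true_and, false_or]
        · by_cases hke : w k = e
          · exact Finset.mem_insert.2 (Or.inl hke)
          · exact Finset.mem_insert_of_mem
              (Finset.mem_insert_of_mem (Finset.mem_erase.2 ⟨hke, hS k⟩))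
    have haE' : a ∉ insert e' (E.erase e) := fun hh => by
      rcases Finset.mem_insert.1 hh with hh | hh
      · exact he'B.1 hh.symm
      · exact ha (Finset.mem_of_mem_erase hh)
    exact (hE'.mem_iff h haE' hcE' hac).trans (hE.mem_iff h hb hcE hbc).symm
  have key2 : ∀ a ∉ E, ∀ b ∉ E, SameType (E.erase e) a b → (a ∈ X ↔ b ∈ X) := by
    intro a ha b hb hab
    by_cases hcut : Less e a → Less e b
    · exact key a ha b hb hab hcut
    · exact (key b hb a ha hab.symm fun hh => (hcut fun _ => hh).elim).symm
  -- the point `e` itself is replaced by a new point of the same type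
  have hrepl : ∀ a ∉ E.erase e, ∃ a' ∉ E, SameType (E.erase e) a a' ∧ (a ∈ X ↔ a' ∈ X) := by
    intro a ha
    by_cases hae : a = e
    · subst hae
      obtain ⟨e', he', -, hst, -, hX, -⟩ := hnew ∅
      exact ⟨e', he', hst, hX⟩
    · exact ⟨a, fun hh => ha (Finset.mem_erase.2 ⟨hae, hh⟩), SameType.refl _ _, Iff.rfl⟩
  refine supports_of_sameType fun a ha b hb hab => ?_
  obtain ⟨a', ha', haa', hXa⟩ := hrepl a ha
  obtain ⟨b', hb', hbb', hXb⟩ := hrepl b hb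
  rw [hXa, hXb]
  exact key2 a' ha' b' hb' ((haa'.symm.trans hab).trans hbb')

theorem exists_least_support (h : IsHomogeneousGeneric M) {X : Set M} (hX : ∃ E, Supports E X) :
    ∃ E, Supports E X ∧ ∀ F, Supports F X → E ⊆ F := by
  classical
  obtain ⟨E, hE⟩ := WellFoundedLT.exists_minimal inferInstance {E | Supports E X} hX
  refine ⟨E, hE.prop, fun F hF e he => ?_⟩
  by_contra heF
  have := hE.le_of_le (hE.prop.erase h hF he heF) (Finset.erase_subset _ _) he
  exact Finset.notMem_erase _ _ this

/-- Over a finite set there are only finitely many types, since `R n` can hold only of tuples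
without repetitions. Hence the set supports only finitely many sets. -/
theorem finite_supports (h : IsHomogeneousGeneric M) (E : Finset M) :
    {X : Set M | Supports E X}.Finite := by
  classical
  let P := {p : Pattern M | Function.Injective p.2.2 ∧ ∀ k, p.2.2 k ∈ E}
  have hP : Finite P := finite_patterns E
  let tp : M → (E → Prop) × (E → Prop) × (P → Prop) := fun a =>
    (fun e => a = e, fun e => Less e.1 a,
      fun p => Holds p.1.1 (p.1.2.1.insertNth a p.1.2.2 : Fin (p.1.1 + 1) → M))
  have key : ∀ X Y : Set M, Supports E X → Supports E Y → tp '' X = tp '' Y → X ⊆ Y := by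
    intro X Y hX hY hXY a ha
    obtain ⟨b, hb, hba⟩ : tp a ∈ tp '' Y := hXY ▸ Set.mem_image_of_mem tp ha
    obtain ⟨h1, h2⟩ := Prod.ext_iff.1 hba
    obtain ⟨h2, h3⟩ := Prod.ext_iff.1 h2
    have h1 : ∀ e ∈ E, (b = e ↔ a = e) := fun e he => iff_of_eq (congrFun h1 ⟨e, he⟩)
    by_cases haE : a ∈ E
    · rwa [← (h1 a haE).2 rfl]
    · have hbE : b ∉ E := fun hh => haE ((h1 b hh).1 rfl ▸ hh)
      refine (hY.mem_iff h hbE haE ⟨fun e he => ?_, fun n i w hw hE => ?_⟩).1 hb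
      · exact iff_of_eq (congrFun h2 ⟨e, he⟩)
      · exact iff_of_eq (congrFun h3 ⟨⟨n, i, w⟩, hw, hE⟩)
  refine Set.Finite.of_finite_image (f := fun X => tp '' X) (Set.toFinite _) ?_
  intro X hX Y hY hXY
  exact (key X Y hX hY hXY).antisymm (key Y X hY hX hXY.symm)

theorem countable_symmetric [Countable M] (h : IsHomogeneousGeneric M) :
    {X : Set M | ∃ E, Supports E X}.Countable := by
  have : {X : Set M | ∃ E, Supports E X} = ⋃ E : Finset M, {X | Supports E X} := by
    ext X
    simp
  rw [this]
  exact Set.countable_iUnion fun E => (finite_supports h E).countable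

end Supports

/-! ### Coding sequences by sets and sets by sequences -/

section Coding

variable {M : Type u} [sig.Structure M]

/-- The set of all `x` such that `R n (z 0, …, z (n - 1), x)`, where `z` is the given sequence of
length `n`. -/
def relSet (l : List M) : Set M :=
  {x | ∃ n, ∃ w : Fin n → M, List.ofFn w = l ∧
    Holds n ((Fin.last n).insertNth x w : Fin (n + 1) → M)}

theorem mem_relSet_ofFn {n : ℕ} {w : Fin n → M} {x : M} :
    x ∈ relSet (List.ofFn w) ↔ Holds n ((Fin.last n).insertNth x w : Fin (n + 1) → M) := by
  refine ⟨fun ⟨m, v, hv, h⟩ => ?_, fun h => ⟨n, w, rfl, h⟩⟩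
  obtain ⟨rfl, h2⟩ := Sigma.mk.inj_iff.1 (List.ofFn_inj'.1 hv)
  rwa [← eq_of_heq h2]

theorem exists_mem_relSet (h : IsHomogeneousGeneric M) {l l' : List M} (hl : l.Nodup)
    (hl' : l'.Nodup) : ∃ x, x ∈ relSet l ∧ (x ∈ relSet l' → l = l') := by
  classical
  obtain ⟨n, w, rfl⟩ : ∃ n, ∃ w : Fin n → M, l = List.ofFn w := ⟨_, l.get, (List.ofFn_get l).symm⟩
  obtain ⟨m, v, rfl⟩ : ∃ n, ∃ w : Fin n → M, l' = List.ofFn w :=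
    ⟨_, l'.get, (List.ofFn_get l').symm⟩
  rw [List.nodup_ofFn] at hl hl'
  obtain ⟨x, -, -, hR⟩ := h.generic (Finset.univ.image w ∪ Finset.univ.image v) (fun _ => False)
    (fun _ _ _ _ _ hh => hh) fun k i z => (⟨k, z⟩ : Σ n, Fin n → M) = ⟨n, w⟩
  refine ⟨x, mem_relSet_ofFn.2 ((hR n _ w hl fun k => ?_).2 rfl), fun hx => ?_⟩
  · exact Finset.mem_union_left _ (Finset.mem_image_of_mem _ (Finset.mem_univ _))
  · refine List.ofFn_inj'.2 ((hR m _ v hl' fun k => ?_).1 (mem_relSet_ofFn.1 hx)).symm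
    exact Finset.mem_union_right _ (Finset.mem_image_of_mem _ (Finset.mem_univ _))

theorem relSet_injOn (h : IsHomogeneousGeneric M) {l l' : List M} (hl : l.Nodup)
    (hl' : l'.Nodup) (hll' : relSet l = relSet l') : l = l' := by
  obtain ⟨x, hx, hx'⟩ := exists_mem_relSet h hl hl'
  exact hx' (hll' ▸ hx)

theorem relSet_ne_empty (h : IsHomogeneousGeneric M) {l : List M} (hl : l.Nodup) :
    relSet l ≠ ∅ := by
  obtain ⟨x, hx, -⟩ := exists_mem_relSet h hl hl
  exact Set.nonempty_iff_ne_empty.1 ⟨x, hx⟩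

theorem apply_mem_relSet_map {π : Equiv.Perm M} (hπ : π ∈ autGroup M) {l : List M} {x : M} :
    π x ∈ relSet (l.map π) ↔ x ∈ relSet l := by
  obtain ⟨n, w, rfl⟩ : ∃ n, ∃ w : Fin n → M, l = List.ofFn w := ⟨_, l.get, (List.ofFn_get l).symm⟩
  rw [List.map_ofFn, mem_relSet_ofFn, mem_relSet_ofFn, ← comp_insertNth, holds_comp_iff hπ]

theorem image_relSet {π : Equiv.Perm M} (hπ : π ∈ autGroup M) (l : List M) :
    π '' relSet l = relSet (l.map π) := by
  ext x
  rw [Equiv.image_eq_preimage_symm, Set.mem_preimage, ← apply_mem_relSet_map hπ,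
    Equiv.apply_symm_apply]

theorem supports_relSet {E : Finset M} {l : List M} (hl : ∀ a ∈ l, a ∈ E) :
    Supports E (relSet l) := by
  intro π hπ hE a
  rw [← apply_mem_relSet_map hπ (x := a), List.map_congr_left fun a ha => hE a (hl a ha),
    List.map_id']

/-- Finite sets of points can be listed equivariantly, in increasing order. -/
theorem exists_equivariant_list (hM : IsModel M) :
    ∃ enum : Finset M → List M, (∀ E a, a ∈ enum E ↔ a ∈ E) ∧
      ∀ π ∈ autGroup M, ∀ E, enum (E.map π.toEmbedding) = (enum E).map π := by
  classical
  let r : M → M → Prop := fun a b => a = b ∨ Less a b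
  have h1 : IsTrans M r := ⟨fun a b c => by
    rintro (rfl | h) (rfl | h')
    · exact Or.inl rfl
    · exact Or.inr h'
    · exact Or.inr h
    · exact Or.inr (hM.less_trans h h')⟩
  have h2 : Std.Antisymm r := ⟨fun a b => by
    rintro (rfl | h) (h' | h')
    · rfl
    · rfl
    · exact h'.symm
    · exact (hM.less_asymm h h').elim⟩
  have h3 : Std.Total r := ⟨fun a b => by
    rcases hM.less_trichotomy a b with h | h | h
    · exact Or.inl (Or.inr h)
    · exact Or.inl (Or.inl h)
    · exact Or.inr (Or.inr h)⟩
  refine ⟨fun E => E.sort r, fun E a => Finset.mem_sort r, fun π hπ E => ?_⟩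
  refine (Finset.map_sort π.toEmbedding E r r fun a _ b _ => ?_).symm
  change (a = b ∨ Less a b) ↔ (π a = π b ∨ Less (π a) (π b))
  rw [less_apply_iff hπ, π.injective.eq_iff]

/-- Sets with finite support can be numbered by natural numbers up to automorphisms. -/
theorem exists_orbit_number [Countable M] (h : IsHomogeneousGeneric M) :
    ∃ c : {X : Set M // ∃ E, Supports E X} → ℕ, ∀ X Y,
      c X = c Y ↔ ∃ π ∈ autGroup M, π '' X.1 = Y.1 := by
  let s : Setoid {X : Set M // ∃ E, Supports E X} :=
    { r := fun X Y => ∃ π ∈ autGroup M, π '' X.1 = Y.1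
      iseqv :=
        ⟨fun X => ⟨1, one_mem _, by simp⟩,
          fun {X Y} ⟨π, hπ, hXY⟩ => ⟨π⁻¹, inv_mem hπ, by
            rw [← hXY, ← Set.image_comp]
            simp⟩,
          fun {X Y Z} ⟨π, hπ, hXY⟩ ⟨ρ, hρ, hYZ⟩ => ⟨ρ * π, mul_mem hρ hπ, by
            rw [← hYZ, ← hXY, ← Set.image_comp]
            rfl⟩⟩ }
  have : Countable {X : Set M // ∃ E, Supports E X} := (countable_symmetric h).to_subtype
  obtain ⟨g, hg⟩ := Countable.exists_injective_nat (Quotient s)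
  exact ⟨fun X => g (Quotient.mk s X), fun X Y => hg.eq_iff.trans Quotient.eq⟩

theorem eq_self_of_map_eq {α : Type*} {f : α → α} {l : List α} (h : l.map f = l) :
    ∀ a ∈ l, f a = a :=
  List.map_inj_left.1 (h.trans l.map_id.symm)

theorem replicate_append_cons_inj {α : Type*} {a b : α} (hab : a ≠ b) {m n : ℕ} {l l' : List α} :
    List.replicate m a ++ b :: l = List.replicate n a ++ b :: l' ↔ m = n ∧ l = l' := by
  refine ⟨fun h => ?_, fun ⟨h, h'⟩ => h ▸ h' ▸ rfl⟩
  induction m generalizing n with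
  | zero =>
    cases n with
    | zero => simpa using h
    | succ n => exact (hab (by simp [List.replicate_succ] at h; exact h.1.symm)).elim
  | succ m ih =>
    cases n with
    | zero => exact (hab (by simp [List.replicate_succ] at h; exact h.1)).elim
    | succ n =>
      simp only [List.replicate_succ, List.cons_append, List.cons.injEq, true_and] at h
      simpa using ih h

/-- Sets with finite support can be coded by finite sequences, equivariantly with respect to the
automorphisms that fix two points `a` and `b`: the sequence lists the least support of the set
after a block of the form `a, …, a, b`, whose length gives the number of the orbit of the set. -/
theorem exists_equivariant_code [Countable M] (h : IsHomogeneousGeneric M) {a b : M}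
    (hab : a ≠ b) : ∃ code : {X : Set M // ∃ E, Supports E X} → List M,
      Function.Injective code ∧ ∀ π ∈ autGroup M, π a = a → π b = b → ∀ X Y,
        π '' X.1 = Y.1 → code Y = (code X).map π := by
  obtain ⟨c, hc⟩ := exists_orbit_number h
  obtain ⟨enum, hmem, henum⟩ := exists_equivariant_list h.isModel
  choose supp hsupp hleast using fun X : {X : Set M // ∃ E, Supports E X} =>
    exists_least_support h X.2
  have himage : ∀ π ∈ autGroup M, ∀ X Y, π '' X.1 = Y.1 →
      supp Y = (supp X).map π.toEmbedding := by
    intro π hπ X Y hXY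
    have hYX : (π⁻¹ : Equiv.Perm M) '' Y.1 = X.1 := by
      rw [← hXY, ← Set.image_comp]
      simp
    have h1 := hleast Y _ (hXY ▸ (hsupp X).image hπ)
    have h2 := hleast X _ (hYX ▸ (hsupp Y).image (inv_mem hπ))
    refine h1.antisymm fun x hx => ?_
    obtain ⟨y, hy, rfl⟩ := Finset.mem_map.1 hx
    obtain ⟨z, hz, rfl⟩ := Finset.mem_map.1 (h2 hy)
    simpa using hz
  refine ⟨fun X => List.replicate (c X) a ++ b :: enum (supp X), fun X Y hXY => ?_,
    fun π hπ ha hb X Y hXY => ?_⟩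
  · obtain ⟨h1, h2⟩ := (replicate_append_cons_inj hab).1 hXY
    obtain ⟨π, hπ, hπX⟩ := (hc X Y).1 h1
    -- an automorphism taking `X` to `Y` preserves the list of the common least support
    rw [himage π hπ X Y hπX, henum π hπ] at h2
    have hfix : ∀ e ∈ supp X, π e = e := fun e he =>
      eq_self_of_map_eq h2.symm e ((hmem _ _).2 he)
    exact Subtype.ext ((image_eq_of_mem_iff (hsupp X π hπ hfix)).symm.trans hπX)
  · have hcXY : c Y = c X := ((hc X Y).2 ⟨π, hπ, hXY⟩).symm
    simp only [himage π hπ X Y hXY, henum π hπ, hcXY, List.map_append, List.map_replicate,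
      List.map_cons, ha, hb]

end Coding

end Categorical

namespace Categorical

open ZFA ZFA.Univ FirstOrder FirstOrder.Language

/-! ### The permutation model of the Fraïssé limit -/

section Model

variable {M : Type u} [sig.Structure M]

theorem isSupport_ofSet_iff {E : Finset M} {X : Set M} :
    IsSupport (autGroup M) E (ofSet X) ↔ Supports E X := by
  constructor
  · intro h π hπ hE a
    have h' := h π hπ hE
    rw [perm_ofSet, ofSet_inj] at h'
    conv_lhs => rw [← h']
    exact π.injective.mem_set_image
  · intro h π hπ hE
    rw [perm_ofSet, image_eq_of_mem_iff (h π hπ hE)]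

theorem mem_of_isSupport_ofList (h : IsHomogeneousGeneric M) {E : Finset M} {l : List M}
    (hl : IsSupport (autGroup M) E (ofList l)) : ∀ a ∈ l, a ∈ E := by
  intro a ha
  by_contra haE
  obtain ⟨π, hπ, hE, hne⟩ := exists_perm_apply_ne h haE
  have h' := hl π hπ hE
  rw [perm_ofList, ofList_inj] at h'
  exact hne (eq_self_of_map_eq h' a ha)

/-- The set of atoms. -/
noncomputable def atoms (M : Type u) [sig.Structure M] : PermModel (autGroup M) :=
  .of (ofSet Set.univ) (.ofSet ⟨∅, isSupport_ofSet_iff.2 fun _ _ _ _ => Iff.rfl⟩)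

/-- The set of all finite one-to-one sequences of atoms. -/
noncomputable def injSeqs (M : Type u) [sig.Structure M] : PermModel (autGroup M) :=
  .of (mkSet fun l : {l : List M // l.Nodup} => ofList l.1)
    (.mkSet ∅ (fun l => .ofList l.1) fun π _ _ l =>
      ⟨⟨l.1.map π, l.2.map π.injective⟩, perm_ofList π l.1⟩)

/-- The set of all sets of atoms with a finite support. -/
noncomputable def powerSet (M : Type u) [sig.Structure M] : PermModel (autGroup M) :=
  .of (mkSet fun X : {X : Set M // ∃ E, Supports E X} => ofSet X.1)
    (.mkSet ∅ (fun X => .ofSet (X.2.imp fun _ => isSupport_ofSet_iff.2)) fun π hπ _ X =>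
      ⟨⟨π '' X.1, X.2.elim fun _ h => ⟨_, h.image hπ⟩⟩, perm_ofSet π X.1⟩)

/-- The set of all finite sequences of atoms. -/
noncomputable def seqs (M : Type u) [sig.Structure M] : PermModel (autGroup M) :=
  .of (mkSet fun l : List M => ofList l)
    (.mkSet ∅ (fun l => .ofList l) fun π _ _ l => ⟨l.map π, perm_ofList π l⟩)

theorem isSet_mkSet {ι : Type u} {f : ι → Univ M}
    (hf : HereditarilySymmetric (autGroup M) (mkSet f)) :
    IsSet (PermModel.of _ hf) :=
  isSet_iff.2 (mkSet_ne_atom f)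

theorem isSetOfAtoms_atoms : IsSetOfAtoms (atoms M) := by
  refine ⟨isSet_iff.2 (ofSet_ne_atom _), fun x => ?_⟩
  rw [mem_def, atoms, PermModel.val_of, mem_ofSet]
  exact ⟨fun ⟨a, _, h⟩ => ⟨a, h⟩, fun ⟨a, h⟩ => ⟨a, trivial, h⟩⟩

theorem isSetOfInjSeq_injSeqs : IsSetOfInjSeq (injSeqs M) (atoms M) := by
  refine ⟨isSet_mkSet _, fun x => ?_⟩
  rw [exists_isInjection_iff isSetOfAtoms_atoms, mem_def, injSeqs, PermModel.val_of, mem_mkSet]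
  exact ⟨fun ⟨l, h⟩ => ⟨l.1, l.2, h⟩, fun ⟨l, hl, h⟩ => ⟨⟨l, hl⟩, h⟩⟩

theorem isPowerSet_powerSet : IsPowerSet (powerSet M) (atoms M) := by
  refine ⟨isSet_mkSet _, fun x => ?_⟩
  rw [isSubset_atoms_iff isSetOfAtoms_atoms, mem_def, powerSet, PermModel.val_of, mem_mkSet]
  refine ⟨fun ⟨X, h⟩ => ⟨X.1, h⟩, fun ⟨X, h⟩ => ⟨⟨X, ?_⟩, h⟩⟩
  exact (h ▸ x.hs.isSymmetric).imp fun _ => isSupport_ofSet_iff.1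

theorem isSetOfSeq_seqs : IsSetOfSeq (seqs M) (atoms M) := by
  refine ⟨isSet_mkSet _, fun x => ?_⟩
  rw [exists_isFunction_iff isSetOfAtoms_atoms, mem_def, seqs, PermModel.val_of, mem_mkSet]

theorem cardLE_injSeqs_powerSet (h : IsHomogeneousGeneric M) :
    CardLE (injSeqs M) (powerSet M) := by
  classical
  refine cardLE_of_equivariant (ψ := fun l : {l : List M // l.Nodup} => ofSet (relSet l.1)) rfl
    (isSet_mkSet _) (fun l l' hl => Subtype.ext (ofList_inj.1 hl))
    (fun l l' hl => Subtype.ext (relSet_injOn h l.2 l'.2 (ofSet_inj.1 hl))) (fun l => ?_) ∅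
    fun π hπ _ l => ⟨⟨l.1.map π, l.2.map π.injective⟩, perm_ofList π l.1, ?_⟩
  · exact mem_mkSet.2 ⟨⟨relSet l.1, l.1.toFinset, supports_relSet fun a ha => by simpa using ha⟩,
      rfl⟩
  · rw [perm_ofSet, image_relSet hπ]

theorem cardLE_powerSet_seqs [Countable M] (h : IsHomogeneousGeneric M) :
    CardLE (powerSet M) (seqs M) := by
  classical
  obtain ⟨a, -⟩ := h.generic ∅ (fun _ => True) (by simp) fun _ _ _ => True
  obtain ⟨b, hb, -⟩ := h.generic {a} (fun _ => True) (fun _ _ _ _ _ _ => trivial)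
    fun _ _ _ => True
  have hab : a ≠ b := fun hh => hb (by simp [hh])
  obtain ⟨code, hinj, hcode⟩ := exists_equivariant_code h hab
  refine cardLE_of_equivariant (ψ := fun X => ofList (code X)) rfl (isSet_mkSet _)
    (fun X Y hXY => Subtype.ext (ofSet_inj.1 hXY)) (fun X Y hXY => hinj (ofList_inj.1 hXY))
    (fun X => mem_mkSet.2 ⟨code X, rfl⟩) {a, b} fun π hπ hE X =>
      ⟨⟨π '' X.1, X.2.elim fun _ h => ⟨_, h.image hπ⟩⟩, perm_ofSet π X.1, ?_⟩
  exact (perm_ofList π _).trans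
    (congrArg ofList (hcode π hπ (hE a (by simp)) (hE b (by simp)) X _ rfl).symm)

/-- A map that commutes with the automorphisms fixing `E` respects the supports that contain `E`. -/
theorem isSupport_of_equivariant {E : Finset M} {Φ : Univ M → Univ M} {x : Univ M}
    (hΦ : ∀ π ∈ autGroup M, (∀ a ∈ E, π a = a) → ∀ a, Mem a x → Mem (perm π a) x →
      Φ (perm π a) = perm π (Φ a)) {F : Finset M} (hEF : E ⊆ F) {y : Univ M} (hy : Mem y x)
    (hF : IsSupport (autGroup M) F y) : IsSupport (autGroup M) F (Φ y) := by
  intro π hπ hfix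
  have hπy := hF π hπ hfix
  rw [← hΦ π hπ (fun a ha => hfix a (hEF ha)) y hy (hπy.symm ▸ hy), hπy]

/-- An injection with support `E` would map the finitely many sets supported by `E` to one-to-one
sequences in `E`. Followed by `relSet`, it would be an injection of a finite set into itself that
misses the empty set. -/
theorem not_cardLE_powerSet_injSeqs (h : IsHomogeneousGeneric M) :
    ¬ CardLE (powerSet M) (injSeqs M) := by
  intro hle
  obtain ⟨E, Φ, hmem, hinj, hΦ⟩ := hle.exists_equivariant
  have hin : ∀ X, Supports E X → Mem (ofSet X) (powerSet M).val := fun X hX =>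
    mem_mkSet.2 ⟨⟨X, E, hX⟩, rfl⟩
  have hex : ∀ X : {X : Set M | Supports E X}, ∃ l : List M, l.Nodup ∧ (∀ a ∈ l, a ∈ E) ∧
      Φ (ofSet X.1) = ofList l := by
    intro X
    obtain ⟨l, hl⟩ := mem_mkSet.1 (hmem _ (hin X.1 X.2))
    refine ⟨l.1, l.2, mem_of_isSupport_ofList h ?_, hl⟩
    rw [← hl]
    exact isSupport_of_equivariant hΦ subset_rfl (hin X.1 X.2) (isSupport_ofSet_iff.2 X.2)
  choose l hnd hlE hl using hex
  have : Finite {X : Set M | Supports E X} := finite_supports h E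
  let g : {X : Set M | Supports E X} → {X : Set M | Supports E X} := fun X =>
    ⟨relSet (l X), supports_relSet (hlE X)⟩
  have hg : Function.Injective g := fun X Y hXY => by
    have h1 := relSet_injOn h (hnd X) (hnd Y) (congrArg Subtype.val hXY)
    exact Subtype.ext (ofSet_inj.1 (hinj _ _ (hin X.1 X.2) (hin Y.1 Y.2)
      (by rw [hl, hl, h1])))
  obtain ⟨X, hX⟩ := (Finite.injective_iff_surjective.1 hg) ⟨∅, fun _ _ _ _ => Iff.rfl⟩
  exact relSet_ne_empty h (hnd X) (congrArg Subtype.val hX)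

/-- An injection with support `E` would map the infinitely many finite sequences in a nonempty
finite set `F` that contains `E` to the finitely many sets supported by `F`. -/
theorem not_cardLE_seqs_powerSet (h : IsHomogeneousGeneric M) :
    ¬ CardLE (seqs M) (powerSet M) := by
  classical
  intro hle
  obtain ⟨E, Φ, hmem, hinj, hΦ⟩ := hle.exists_equivariant
  obtain ⟨a, -⟩ := h.generic ∅ (fun _ => True) (by simp) fun _ _ _ => True
  have hin : ∀ l : List M, Mem (ofList l) (seqs M).val := fun l => mem_mkSet.2 ⟨l, rfl⟩
  have hex : ∀ n : ℕ, ∃ X : Set M, Supports (insert a E) X ∧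
      Φ (ofList (List.replicate n a)) = ofSet X := by
    intro n
    obtain ⟨X, hX⟩ := mem_mkSet.1 (hmem _ (hin (List.replicate n a)))
    refine ⟨X.1, isSupport_ofSet_iff.1 ?_, hX⟩
    rw [← hX]
    refine isSupport_of_equivariant hΦ (Finset.subset_insert a E) (hin _) (isSupport_ofList ?_)
    intro b hb
    rw [List.eq_of_mem_replicate hb]
    exact Finset.mem_insert_self a E
  choose X hX hΦX using hex
  refine Set.infinite_of_injective_forall_mem (f := X) (fun m n hmn => ?_) hX
    (finite_supports h (insert a E))
  have := ofList_inj.1 (hinj _ _ (hin _) (hin _) ((hΦX m).trans (hmn ▸ (hΦX n).symm)))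
  simpa using congrArg List.length this

end Model

end Categorical

/-- A countable Fraïssé limit `M` of the finite linearly ordered structures with relations `R n`
exists, and for every such `M` the permutation model with set of atoms `M`, the automorphism group
of `M` and finite supports satisfies `Seq(𝔪) < 2 ^ 𝔪 < seq(𝔪)`, where `𝔪` is the cardinality of the
set of atoms. -/
theorem mainTheorem1 :
    (∃ (M : Type u) (_ : Categorical.sig.Structure M) (_ : Countable M),
      FirstOrder.Language.IsFraisseLimit Categorical.finModels.{u} M) ∧
    ∀ (M : Type u) [Categorical.sig.Structure M] [Countable M],
      FirstOrder.Language.IsFraisseLimit Categorical.finModels.{u} M →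
        ZFA.InjSeqLTPowerLTSeq (ZFA.PermModel (Categorical.autGroup M)) := by
  open Categorical in
  refine ⟨⟨RatModel, inferInstance, inferInstance,
    isFraisseLimit_of_generic RatModel.isModel RatModel.generic⟩, fun M _ _ hM => ?_⟩
  have h := isHomogeneousGeneric hM
  exact ⟨atoms M, injSeqs M, powerSet M, seqs M, isSetOfAtoms_atoms, isSetOfInjSeq_injSeqs,
    isPowerSet_powerSet, isSetOfSeq_seqs,
    ⟨cardLE_injSeqs_powerSet h, not_cardLE_powerSet_injSeqs h⟩,
    ⟨cardLE_powerSet_seqs h, not_cardLE_seqs_powerSet h⟩⟩
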